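/- For a function \(f:\mathbb{R}\to\mathbb{R}\) let \(Mf(x)=\sup_{a<x<b}\frac1{b-a}\int_a^b f(t)\,dt\) be its uncentered Hardy--Littlewood maximal function (without absolute values). For \(g\in L^1_{\mathrm{loc}}(\mathbb{R})\) let \(\operatorname{var}(g)=\sup\{-\int_{\mathbb{R}} g\varphi' : \varphi\in C^1_c(\mathbb{R}),\ |\varphi|\le 1\}\in[0,\infty]\). Let \(\operatorname{var}(f')\) denote the variation of the weak derivative of \(f\), with \(\operatorname{var}(f')=\infty\) if \(f\) is not locally integrable with a locally integrable weak derivative. **Theorem.** For every \(c>0\) there exists a \(C>0\) such that the following holds. Let \(f:\mathbb{R}\to\mathbb{R}\) be nondecreasing on \((-\infty,0)\) and nonincreasing on \((0,\infty)\), and suppose that \[ Mf(x)=\sup_{y\ge -cx,\ y\ne x}\frac1{x-y}\int_y^x f(t)\,dt\quad\text{for every }x>0, \] \[ Mf(x)=\sup_{y\le -cx,\ y\ne x}\frac1{x-y}\int_y^x f(t)\,dt\quad\text{for every }x<0. \] Then \(\operatorname{var}((Mf)')\le C\operatorname{var}(f')\). In particular, if \(f\) is weakly differentiable and \(\operatorname{var}(f')<\infty\),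 then \(Mf\) is weakly differentiable and \((Mf)'\) has finite variation. -/

import Mathlib

open MeasureTheory Set
open scoped ENNReal

noncomputable section

namespace SecondDerivMaximal

/-- The average `(b - a)⁻¹ ∫_a^b f`. It is symmetric in `a` and `b`, and it is only used
for `a ≠ b`. -/
def average (f : ℝ → ℝ) (a b : ℝ) : ℝ :=
  (b - a)⁻¹ * ∫ t in a..b, f t

/-- The uncentered Hardy-Littlewood maximal function (without absolute values),
`M f x = sup_{a < x < b} (b - a)⁻¹ ∫_a^b f`. The supremum is finite for every `f` which is
bounded above, in particular for every weakly differentiable `f` that is nondecreasing on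
`(-∞, 0)` and nonincreasing on `(0, ∞)`. -/
def maximal (f : ℝ → ℝ) (x : ℝ) : ℝ :=
  sSup {m : ℝ | ∃ a b : ℝ, a < x ∧ x < b ∧ m = average f a b}

/-- `g` is a weak derivative of `f` on `ℝ`. -/
structure HasWeakDeriv (f g : ℝ → ℝ) : Prop where
  locallyIntegrable : LocallyIntegrable f
  locallyIntegrable_deriv : LocallyIntegrable g
  integral_eq : ∀ φ : ℝ → ℝ, ContDiff ℝ 1 φ → HasCompactSupport φ →
    ∫ x, g x * φ x = -∫ x, f x * deriv φ x

/-- The variation of a locally integrable function `g` on `ℝ`: the supremum of `-∫ g φ'`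
over all `φ` in `C¹_c(ℝ)` with `|φ| ≤ 1`. (The supremum is nonnegative, as `φ = 0` is
admissible.) -/
def variation (g : ℝ → ℝ) : ℝ≥0∞ :=
  ⨆ (φ : ℝ → ℝ) (_ : ContDiff ℝ 1 φ) (_ : HasCompactSupport φ) (_ : ∀ x, |φ x| ≤ 1),
    ENNReal.ofReal (-∫ x, g x * deriv φ x)

/-- `var(f')`, the variation of the weak derivative of `f`. Weak derivatives are unique up to
null sets and `variation` does not see null sets, so the infimum is over a single value; it
is `∞` if `f` has no weak derivative. -/
def variationDeriv (f : ℝ → ℝ) : ℝ≥0∞ :=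
  ⨅ (g : ℝ → ℝ) (_ : HasWeakDeriv f g), variation g

end SecondDerivMaximal

end

/-!
Write `F` for the continuous representative of `f`. On `x > 0`, the number `N x = F 0 - M F x` is
the minimum over `t ≥ 0` of the averages of `F 0 - F` over `[-t, x]`, and it is attained at some
`s x ≤ c x`. The envelope theorem gives `N' x = (F 0 - F x - N x) / (x + s x)`, and the optimality
of `s x` gives `F 0 - F (-s x) = N x`. In terms of the ratio `r = s x / x ∈ [0, c]` both the slope
and the optimality condition are algebraic in mean values of `f'` over `[0, x]` and `[-s x, 0]` and
in iterated such mean values. As functions of `x` these are averages of dilates of `f'`, composed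
with the monotone `s`, hence their variation is at most that of `f'`.

The ratio `r` itself need not have bounded variation. But the total variation of a bounded function
is controlled by its upward variation, and the slope can increase through `r` only where `r`
decreases. A decrease of `r` is slow because `s = x r` is nondecreasing, and the optimality
condition bounds the resulting increase of the slope by the variation of the mean values.
-/

open Filter Topology

namespace SecondDerivMaximal

section BoundedVariation

variable {α E : Type*} [LinearOrder α]

theorem eVariationOn_le_of_dist_le_sub [PseudoMetricSpace E] {f : α → E} {T : α → ℝ} {s : Set α}
    {a b : ℝ} (hf : ∀ x ∈ s, ∀ y ∈ s, x ≤ y → dist (f y) (f x) ≤ T y - T x)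
    (hT : MapsTo T s (Icc a b)) : eVariationOn f s ≤ ENNReal.ofReal (b - a) := by
  refine iSup_le fun ⟨n, u, hu, hus⟩ ↦ ?_
  have hstep (i : ℕ) : dist (f (u (i + 1))) (f (u i)) ≤ T (u (i + 1)) - T (u i) :=
    hf _ (hus i) _ (hus (i + 1)) (hu i.le_succ)
  calc ∑ i ∈ Finset.range n, edist (f (u (i + 1))) (f (u i))
      ≤ ∑ i ∈ Finset.range n, ENNReal.ofReal (T (u (i + 1)) - T (u i)) := by
        gcongr with i
        rw [edist_dist]
        exact ENNReal.ofReal_le_ofReal (hstep i)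
    _ = ENNReal.ofReal (T (u n) - T (u 0)) := by
        rw [← ENNReal.ofReal_sum_of_nonneg fun i _ ↦ dist_nonneg.trans (hstep i),
          Finset.sum_range_sub fun i ↦ T (u i)]
    _ ≤ ENNReal.ofReal (b - a) :=
        ENNReal.ofReal_le_ofReal (sub_le_sub (hT (hus n)).2 (hT (hus 0)).1)

theorem exists_monotone_dist_le_sub [PseudoMetricSpace E] {f : α → E} {s : Set α}
    (hf : BoundedVariationOn f s) :
    ∃ v : α → ℝ, Monotone v ∧ (∀ x, v x ∈ Icc 0 (eVariationOn f s).toReal) ∧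
      ∀ x ∈ s, ∀ y ∈ s, x ≤ y → dist (f y) (f x) ≤ v y - v x := by
  have hfin (x : α) : eVariationOn f (s ∩ Iic x) ≠ ⊤ := hf.mono inter_subset_left
  refine ⟨fun x ↦ (eVariationOn f (s ∩ Iic x)).toReal, fun x y hxy ↦ ?_, fun x ↦ ?_,
    fun x hx y hy hxy ↦ ?_⟩
  · exact ENNReal.toReal_mono (hfin y) (eVariationOn.mono f (by gcongr))
  · exact ⟨ENNReal.toReal_nonneg, ENNReal.toReal_mono hf (eVariationOn.mono f inter_subset_left)⟩
  · have hadd : eVariationOn f (s ∩ Iic x) + edist (f y) (f x) ≤ eVariationOn f (s ∩ Iic y) := by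
      calc eVariationOn f (s ∩ Iic x) + edist (f y) (f x)
          ≤ eVariationOn f (s ∩ Iic x) + eVariationOn f (s ∩ Icc x y) := by
            gcongr
            exact eVariationOn.edist_le f ⟨hy, hxy, le_rfl⟩ ⟨hx, le_rfl, hxy⟩
        _ ≤ eVariationOn f (s ∩ Iic x ∪ s ∩ Icc x y) :=
            eVariationOn.add_le_union f fun a ha b hb ↦ ha.2.trans hb.2.1
        _ ≤ eVariationOn f (s ∩ Iic y) := eVariationOn.mono f (union_subset
            (inter_subset_inter_right s (Iic_subset_Iic.2 hxy))
            (inter_subset_inter_right s Icc_subset_Iic_self))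
    have := ENNReal.toReal_mono (hfin y) hadd
    rw [ENNReal.toReal_add (hfin x) (edist_ne_top _ _), edist_dist,
      ENNReal.toReal_ofReal dist_nonneg] at this
    linarith

/- On `s` the function factors through its own variation function `v` as a `1`-Lipschitz function
on `v '' s`, which extends to `ℝ`. -/
theorem exists_eqOn_eVariationOn_univ_le {f : α → ℝ} {s : Set α} (hf : BoundedVariationOn f s) :
    ∃ g : α → ℝ, EqOn f g s ∧ eVariationOn g univ ≤ eVariationOn f s := by
  cases isEmpty_or_nonempty α
  · exact ⟨f, eqOn_refl f s, by rw [Subsingleton.elim univ s]⟩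
  obtain ⟨v, hv, hvmem, hfv⟩ := exists_monotone_dist_le_sub hf
  have hdist : ∀ x ∈ s, ∀ y ∈ s, dist (f x) (f y) ≤ dist (v x) (v y) := fun x hx y hy ↦ by
    rcases le_total x y with hxy | hyx
    · rw [dist_comm (f x), dist_comm (v x)]
      exact (hfv x hx y hy hxy).trans (le_abs_self _)
    · exact (hfv y hy x hx hyx).trans (le_abs_self _)
  choose! c hcs hvc using fun (t : ℝ) (ht : t ∈ v '' s) ↦ ht
  have hlip : LipschitzOnWith 1 (f ∘ c) (v '' s) := .of_dist_le_mul fun t ht t' ht' ↦ by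
    simpa [hvc t ht, hvc t' ht'] using hdist _ (hcs t ht) _ (hcs t' ht')
  obtain ⟨G, hG, hGeq⟩ := hlip.extend_real
  refine ⟨G ∘ v, fun x hx ↦ ?_, ?_⟩
  · have hvx := mem_image_of_mem v hx
    have := hdist x hx _ (hcs _ hvx)
    rw [hvc _ hvx, dist_self] at this
    exact (dist_le_zero.1 this).trans (hGeq hvx)
  · rw [← ENNReal.ofReal_toReal hf, ← sub_zero (eVariationOn f s).toReal]
    refine eVariationOn_le_of_dist_le_sub (T := v) (fun x _ y _ hxy ↦ ?_) fun x _ ↦ hvmem x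
    simpa [Real.dist_eq, abs_of_nonneg (sub_nonneg.2 (hv hxy))]
      using hG.dist_le_mul (v y) (v x)

theorem eVariationOn_integral_le [NormedAddCommGroup E] [NormedSpace ℝ E] {β : Type*}
    [MeasurableSpace β] {μ : Measure β} {F : β → α → E} {s : Set α} {C : ℝ≥0∞}
    (hint : ∀ x ∈ s, Integrable (F · x) μ) (hF : ∀ᵐ u ∂μ, eVariationOn (F u) s ≤ C) :
    eVariationOn (fun x ↦ ∫ u, F u x ∂μ) s ≤ C * μ univ := by
  refine iSup_le fun ⟨n, p, hp, hps⟩ ↦ ?_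
  calc ∑ i ∈ Finset.range n, edist (∫ u, F u (p (i + 1)) ∂μ) (∫ u, F u (p i) ∂μ)
      ≤ ∑ i ∈ Finset.range n, ∫⁻ u, edist (F u (p (i + 1))) (F u (p i)) ∂μ := by
        gcongr with i
        simp only [edist_eq_enorm_sub]
        rw [← integral_sub (hint _ (hps _)) (hint _ (hps _))]
        exact enorm_integral_le_lintegral_enorm _
    _ = ∫⁻ u, ∑ i ∈ Finset.range n, edist (F u (p (i + 1))) (F u (p i)) ∂μ := by
        refine (lintegral_finsetSum' _ fun i _ ↦ ?_).symm
        exact (hint _ (hps _)).aestronglyMeasurable.edist (hint _ (hps _)).aestronglyMeasurable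
    _ ≤ ∫⁻ _, C ∂μ :=
        lintegral_mono_ae (hF.mono fun u hu ↦ (eVariationOn.sum_le hp hps).trans hu)
    _ = C * μ univ := lintegral_const C

theorem eVariationOn_le_of_sub_le_sub {f S : α → ℝ} {s : Set α} {B W : ℝ}
    (hf : MapsTo f s (Icc 0 B)) (hS_mono : MonotoneOn S s) (hS : MapsTo S s (Icc 0 W))
    (hfS : ∀ x ∈ s, ∀ y ∈ s, x ≤ y → f y - f x ≤ S y - S x) :
    eVariationOn f s ≤ ENNReal.ofReal (B + 2 * W) := by
  rw [show B + 2 * W = 2 * W - -B by ring]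
  refine eVariationOn_le_of_dist_le_sub (T := fun x ↦ 2 * S x - f x) (fun x hx y hy hxy ↦ ?_)
    fun x hx ↦ ⟨?_, ?_⟩
  · rw [Real.dist_eq, abs_le]
    constructor <;> linarith [hfS x hx y hy hxy, hS_mono hx hy hxy]
  · linarith [(hf hx).2, (hS hx).1]
  · linarith [(hf hx).1, (hS hx).2]

theorem eVariationOn_sub_le [SeminormedAddCommGroup E] (f g : α → E) (s : Set α) :
    eVariationOn (f - g) s ≤ eVariationOn f s + eVariationOn g s := by
  refine iSup_le fun ⟨n, u, hu, hus⟩ ↦ ?_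
  calc ∑ i ∈ Finset.range n, edist ((f - g) (u (i + 1))) ((f - g) (u i))
      ≤ ∑ i ∈ Finset.range n,
          (edist (f (u (i + 1))) (f (u i)) + edist (g (u (i + 1))) (g (u i))) := by
        gcongr with i
        simp only [edist_eq_enorm_sub, Pi.sub_apply]
        rw [sub_sub_sub_comm]
        exact enorm_sub_le
    _ ≤ eVariationOn f s + eVariationOn g s := by
        rw [Finset.sum_add_distrib]
        exact add_le_add (eVariationOn.sum_le hu hus) (eVariationOn.sum_le hu hus)

theorem eVariationOn_comp_neg_le [AddCommGroup α] [IsOrderedAddMonoid α] [PseudoEMetricSpace E]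
    (g : α → E) : eVariationOn (fun x ↦ g (-x)) univ ≤ eVariationOn g univ :=
  eVariationOn.comp_le_of_antitoneOn g (fun x ↦ -x) (fun _ _ _ _ ↦ neg_le_neg) (mapsTo_univ _ _)

theorem eVariationOn_neg_le [SeminormedAddCommGroup E] (g : α → E) (s : Set α) :
    eVariationOn (-g) s ≤ eVariationOn g s := by
  simpa [Function.comp_def, Pi.neg_def] using
    (LipschitzWith.id (α := E)).neg.lipschitzOnWith.comp_eVariationOn_le (mapsTo_univ g s)

theorem eVariationOn_indicator_Ioi_le {f : α → ℝ} {a : α} {B W : ℝ}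
    (hfB : MapsTo f (Ioi a) (Icc 0 B)) (hfW : eVariationOn f (Ioi a) ≤ ENNReal.ofReal W)
    (hB : 0 ≤ B) (hW : 0 ≤ W) :
    eVariationOn ((Ioi a).indicator f) univ ≤ ENNReal.ofReal (W + B) := by
  obtain ⟨v, -, hv, hfv⟩ := exists_monotone_dist_le_sub (hfW.trans_lt ENNReal.ofReal_lt_top).ne
  have hvW (x : α) : v x ≤ W := (hv x).2.trans (ENNReal.toReal_le_of_le_ofReal hW hfW)
  rw [← sub_neg_eq_add]
  refine eVariationOn_le_of_dist_le_sub (T := fun x ↦ if a < x then v x else -B)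
    (fun x _ y _ hxy ↦ ?_) fun x _ ↦ ?_
  · by_cases hx : a < x
    · have hy := hx.trans_le hxy
      simpa [hx, hy] using hfv x hx y hy hxy
    by_cases hy : a < y
    · simp only [indicator, mem_Ioi, hx, hy, if_true, if_false, dist_zero_right]
      rw [Real.norm_of_nonneg (hfB hy).1]
      linarith [(hfB hy).2, (hv y).1]
    · simp [hx, hy]
  · dsimp only
    split_ifs
    · exact ⟨by linarith [(hv x).1], hvW x⟩
    · exact ⟨le_rfl, by linarith⟩

end BoundedVariation

section Mollification

open scoped Convolution

variable {ρ g : ℝ → ℝ} {a b : ℝ}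

theorem hasDerivAt_integral_comp_sub (hρ : Continuous ρ) (a b t : ℝ) :
    HasDerivAt (fun t ↦ ∫ s in a..b, ρ (s - t)) (ρ (a - t) - ρ (b - t)) t := by
  have hprim (x : ℝ) : HasDerivAt (fun x ↦ ∫ s in (0 : ℝ)..x, ρ s) (ρ x) x :=
    hρ.integral_hasStrictDerivAt 0 x |>.hasDerivAt
  have heq : (fun t ↦ ∫ s in a..b, ρ (s - t)) =
      fun t ↦ (∫ s in (0 : ℝ)..b - t, ρ s) - ∫ s in (0 : ℝ)..a - t, ρ s := by
    ext t
    rw [intervalIntegral.integral_comp_sub_right, intervalIntegral.integral_interval_sub_left] <;>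
    exact hρ.intervalIntegrable _ _
  rw [heq, ← neg_sub_neg]
  exact ((hprim _).comp_const_sub b t).sub ((hprim _).comp_const_sub a t)

theorem hasCompactSupport_integral_comp_sub (hρ : HasCompactSupport ρ) (a b : ℝ) :
    HasCompactSupport fun t ↦ ∫ s in a..b, ρ (s - t) := by
  have hcompact : IsCompact ((fun p : ℝ × ℝ ↦ p.1 - p.2) '' uIcc a b ×ˢ tsupport ρ) :=
    (isCompact_uIcc.prod hρ.isCompact).image continuous_sub
  refine .intro hcompact fun t ht ↦ ?_
  refine intervalIntegral.integral_zero_ae <| ae_of_all _ fun s hs ↦ ?_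
  exact image_eq_zero_of_notMem_tsupport fun hst ↦
    ht ⟨(s, s - t), ⟨uIoc_subset_uIcc hs, hst⟩, sub_sub_cancel s t⟩

theorem abs_sum_mul_integral_comp_sub_le (hρ : Continuous ρ) (hρ_nonneg : 0 ≤ ρ)
    (hρ_int : Integrable ρ) (σ : ℕ → SignType) {u : ℕ → ℝ} (hu : Monotone u) (n : ℕ) (t : ℝ) :
    |∑ i ∈ Finset.range n, σ i * ∫ s in u i..u (i + 1), ρ (s - t)| ≤ ∫ s, ρ s := by
  have hnonneg (i : ℕ) : 0 ≤ ∫ s in u i..u (i + 1), ρ (s - t) :=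
    intervalIntegral.integral_nonneg (hu i.le_succ) fun s _ ↦ hρ_nonneg (s - t)
  calc |∑ i ∈ Finset.range n, σ i * ∫ s in u i..u (i + 1), ρ (s - t)|
      ≤ ∑ i ∈ Finset.range n, ∫ s in u i..u (i + 1), ρ (s - t) := by
        refine (Finset.abs_sum_le_sum_abs _ _).trans (Finset.sum_le_sum fun i _ ↦ ?_)
        rw [abs_mul, abs_of_nonneg (hnonneg i)]
        exact mul_le_of_le_one_left (hnonneg i) (by cases σ i <;> simp)
    _ = ∫ s in u 0..u n, ρ (s - t) :=
        intervalIntegral.sum_integral_adjacent_intervals fun i _ ↦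
          (hρ.comp (continuous_sub_right t)).intervalIntegrable _ _
    _ ≤ ∫ s, ρ (s - t) := by
        rw [intervalIntegral.integral_of_le (hu n.zero_le)]
        exact setIntegral_le_integral (hρ_int.comp_sub_right t)
          (ae_of_all _ fun s ↦ hρ_nonneg (s - t))
    _ = ∫ s, ρ s := integral_sub_right_eq_self ρ t

theorem le_variation {φ : ℝ → ℝ} (hφ : ContDiff ℝ 1 φ) (hφ_supp : HasCompactSupport φ)
    (hφ_le : ∀ x, |φ x| ≤ 1) : ENNReal.ofReal (-∫ x, g x * deriv φ x) ≤ variation g :=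
  le_iSup₂_of_le φ hφ <| le_iSup₂_of_le hφ_supp hφ_le le_rfl

theorem eVariationOn_le_of_sum_sign_mul_sub_le {α : Type*} [LinearOrder α] {f : α → ℝ} {s : Set α}
    {C : ℝ≥0∞} (hf : ∀ (σ : ℕ → SignType) (u : ℕ → α) (n : ℕ), Monotone u → (∀ i, u i ∈ s) →
      ENNReal.ofReal (∑ i ∈ Finset.range n, σ i * (f (u (i + 1)) - f (u i))) ≤ C) :
    eVariationOn f s ≤ C := by
  refine iSup_le fun ⟨n, u, hu, hus⟩ ↦ ?_
  simp only [edist_dist, ← ENNReal.ofReal_sum_of_nonneg fun _ _ ↦ dist_nonneg]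
  simpa only [sign_mul_self, ← Real.dist_eq]
    using hf (fun i ↦ SignType.sign (f (u (i + 1)) - f (u i))) u n hu hus

theorem sum_mul_convolution_sub_eq (hρ : Continuous ρ) (hρ_supp : HasCompactSupport ρ)
    (hg : LocallyIntegrable g) (σ u : ℕ → ℝ) (n : ℕ) :
    ∑ i ∈ Finset.range n, σ i * ((ρ ⋆[ContinuousLinearMap.lsmul ℝ ℝ] g) (u (i + 1)) -
        (ρ ⋆[ContinuousLinearMap.lsmul ℝ ℝ] g) (u i)) =
      -∫ t, g t * ∑ i ∈ Finset.range n, σ i * (ρ (u i - t) - ρ (u (i + 1) - t)) := by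
  have hint (y : ℝ) : Integrable fun t ↦ g t * ρ (y - t) :=
    hg.integrable_smul_right_of_hasCompactSupport (hρ.comp (continuous_sub_left y))
      (hρ_supp.comp_homeomorph (Homeomorph.subLeft y))
  calc ∑ i ∈ Finset.range n, σ i * ((ρ ⋆[ContinuousLinearMap.lsmul ℝ ℝ] g) (u (i + 1)) -
          (ρ ⋆[ContinuousLinearMap.lsmul ℝ ℝ] g) (u i))
      = ∑ i ∈ Finset.range n, ∫ t, σ i * (g t * ρ (u (i + 1) - t) - g t * ρ (u i - t)) := by
        simp only [convolution_eq_swap, ContinuousLinearMap.lsmul_apply, smul_eq_mul,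
          mul_comm (ρ _), ← integral_sub (hint _) (hint _), integral_const_mul]
    _ = -∫ t, g t * ∑ i ∈ Finset.range n, σ i * (ρ (u i - t) - ρ (u (i + 1) - t)) := by
        rw [← integral_finsetSum _ fun _ _ ↦ by exact ((hint _).sub (hint _)).const_mul _,
          ← integral_neg]
        congr with t
        rw [Finset.mul_sum, ← Finset.sum_neg_distrib]
        exact Finset.sum_congr rfl fun _ _ ↦ by ring

theorem eVariationOn_convolution_le_variation (hρ : Continuous ρ) (hρ_supp : HasCompactSupport ρ)
    (hρ_nonneg : 0 ≤ ρ) (hρ_integral : ∫ x, ρ x = 1) (hg : LocallyIntegrable g) :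
    eVariationOn (ρ ⋆[ContinuousLinearMap.lsmul ℝ ℝ] g) univ ≤ variation g := by
  refine eVariationOn_le_of_sum_sign_mul_sub_le fun σ u n hu _ ↦ ?_
  let φ (t : ℝ) : ℝ := ∑ i ∈ Finset.range n, σ i * ∫ s in u i..u (i + 1), ρ (s - t)
  have hφ (t : ℝ) : HasDerivAt φ
      (∑ i ∈ Finset.range n, σ i * (ρ (u i - t) - ρ (u (i + 1) - t))) t :=
    HasDerivAt.fun_sum fun i _ ↦ (hasDerivAt_integral_comp_sub hρ _ _ t).const_mul _
  have hφ_contDiff : ContDiff ℝ 1 φ := contDiff_one_iff_deriv.2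
    ⟨fun t ↦ (hφ t).differentiableAt, by rw [funext fun t ↦ (hφ t).deriv]; fun_prop⟩
  have hφ_supp : HasCompactSupport φ := by
    simp only [φ, ← Finset.sum_fn]
    refine Finset.sum_induction _ HasCompactSupport (fun _ _ ↦ .add) .zero fun i _ ↦ ?_
    exact (hasCompactSupport_integral_comp_sub hρ_supp _ _).mul_left
  have hφ_le (t : ℝ) : |φ t| ≤ 1 := hρ_integral ▸ abs_sum_mul_integral_comp_sub_le hρ hρ_nonneg
    (hρ.integrable_of_hasCompactSupport hρ_supp) σ hu n t
  rw [sum_mul_convolution_sub_eq hρ hρ_supp hg (fun i ↦ σ i)]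
  simpa only [(hφ _).deriv] using le_variation hφ_contDiff hφ_supp hφ_le

theorem exists_ae_eVariationOn_le_variation (hg : LocallyIntegrable g) :
    ∃ s : Set ℝ, (∀ᵐ x, x ∈ s) ∧ eVariationOn g s ≤ variation g := by
  let ρ (n : ℕ) : ContDiffBump (0 : ℝ) :=
    ⟨1 / ((n : ℝ) + 1), 2 * (1 / ((n : ℝ) + 1)), Nat.one_div_pos_of_nat,
      lt_two_mul_self Nat.one_div_pos_of_nat⟩
  have hρ : Tendsto (fun n ↦ (ρ n).rOut) atTop (𝓝 0) := by
    simpa only [mul_zero] using (tendsto_one_div_add_atTop_nhds_zero_nat (𝕜 := ℝ)).const_mul 2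
  refine ⟨_, ContDiffBump.ae_convolution_tendsto_right_of_locallyIntegrable hρ
    (.of_forall fun n ↦ le_refl (2 * (ρ n).rIn)) hg, ?_⟩
  by_contra! hlt
  obtain ⟨n, hn⟩ := (eVariationOn.lowerSemicontinuous_aux (fun x hx ↦ hx) hlt).exists
  refine hn.not_ge <| (eVariationOn.mono _ (subset_univ _)).trans <|
    eVariationOn_convolution_le_variation (ρ n).continuous_normed (ρ n).hasCompactSupport_normed
      (ρ n).nonneg_normed (ρ n).integral_normed hg

theorem exists_ae_eq_eVariationOn_le_variation (hg : LocallyIntegrable g) (hvar : variation g ≠ ⊤) :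
    ∃ k : ℝ → ℝ, g =ᵐ[volume] k ∧ eVariationOn k univ ≤ variation g := by
  obtain ⟨s, hs, hgs⟩ := exists_ae_eVariationOn_le_variation hg
  obtain ⟨k, hgk, hk⟩ := exists_eqOn_eVariationOn_univ_le (ne_top_of_le_ne_top hvar hgs)
  exact ⟨k, hs.mono hgk, hk.trans hgs⟩

end Mollification

section BoundedVariationWeak

theorem antitone_of_sub_le_mul_sub {G v : ℝ → ℝ} {M : ℝ}
    (hG : ∀ x y, x ≤ y → G y - G x ≤ M * (y - x) * (v y - v x)) : Antitone G := by
  intro a b hab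
  have hbound (n : ℕ) : G b - G a ≤ M * (b - a) * (v b - v a) / (n + 1) := by
    let p (i : ℕ) : ℝ := a + i * ((b - a) / (n + 1))
    have hp_zero : p 0 = a := by simp [p]
    have hp_last : p (n + 1) = b := by simp only [p, Nat.cast_succ]; field_simp; ring
    have hp_succ (i : ℕ) : p (i + 1) - p i = (b - a) / (n + 1) := by
      simp only [p, Nat.cast_succ]; ring
    have hp_le (i : ℕ) : p i ≤ p (i + 1) := by
      rw [← sub_nonneg, hp_succ]; exact div_nonneg (sub_nonneg.2 hab) (by positivity)
    calc G b - G a = ∑ i ∈ Finset.range (n + 1), (G (p (i + 1)) - G (p i)) := by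
          rw [Finset.sum_range_sub fun i ↦ G (p i), hp_zero, hp_last]
      _ ≤ ∑ i ∈ Finset.range (n + 1), M * ((b - a) / (n + 1)) * (v (p (i + 1)) - v (p i)) := by
          gcongr with i
          exact hp_succ i ▸ hG _ _ (hp_le i)
      _ = M * (b - a) * (v b - v a) / (n + 1) := by
          rw [← Finset.mul_sum, Finset.sum_range_sub fun i ↦ v (p i), hp_zero, hp_last]
          ring
  have hlim : Tendsto (fun n : ℕ ↦ M * (b - a) * (v b - v a) / ((n : ℝ) + 1)) atTop (𝓝 0) :=
    tendsto_const_nhds.div_atTop (tendsto_natCast_atTop_atTop.atTop_add tendsto_const_nhds)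
  exact sub_nonpos.1 (ge_of_tendsto' hlim hbound)

theorem locallyIntegrable_of_boundedVariationOn {h : ℝ → ℝ} (hh : BoundedVariationOn h univ) :
    LocallyIntegrable h := by
  obtain ⟨p, q, hp, hq, rfl⟩ := hh.locallyBoundedVariationOn.exists_monotoneOn_sub_monotoneOn
  exact (monotoneOn_univ.1 hp).locallyIntegrable.sub (monotoneOn_univ.1 hq).locallyIntegrable

theorem intervalIntegrable_of_boundedVariationOn {h : ℝ → ℝ} (hh : BoundedVariationOn h univ)
    (a b : ℝ) : IntervalIntegrable h volume a b :=
  ((locallyIntegrable_of_boundedVariationOn hh).integrableOn_isCompact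
    isCompact_uIcc).intervalIntegrable

theorem neg_integral_mul_deriv_le {h v φ : ℝ → ℝ} (hh : BoundedVariationOn h univ)
    (hv : ∀ x y, x ≤ y → |h y - h x| ≤ v y - v x) (hφ : ContDiff ℝ 1 φ) {M : ℝ}
    (hφ_le : ∀ x, |φ x| ≤ 1) (hφ_deriv : ∀ x, |deriv φ x| ≤ M) {a b : ℝ} (hab : a ≤ b) :
    -∫ t in a..b, h t * deriv φ t ≤ v b - v a - (h b * φ b - h a * φ a) := by
  have hcont : Continuous (deriv φ) := hφ.continuous_deriv_one
  have hint (x y : ℝ) : IntervalIntegrable (fun t ↦ h t * deriv φ t) volume x y :=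
    (intervalIntegrable_of_boundedVariationOn hh x y).mul_continuousOn hcont.continuousOn
  have hanti : Antitone fun y ↦ -(∫ t in a..y, h t * deriv φ t) + h y * φ y - v y := by
    refine antitone_of_sub_le_mul_sub (v := v) (M := M) fun x y hxy ↦ ?_
    have hsplit : ∫ t in x..y, h t * deriv φ t =
        (∫ t in x..y, (h t - h x) * deriv φ t) + h x * (φ y - φ x) := by
      simp only [sub_mul]
      rw [intervalIntegral.integral_sub (hint x y) ((hcont.const_mul _).intervalIntegrable x y),
        intervalIntegral.integral_const_mul, intervalIntegral.integral_deriv_eq_sub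
          (fun t _ ↦ hφ.differentiable one_ne_zero t) (hcont.intervalIntegrable x y)]
      ring
    have hosc : ‖∫ t in x..y, (h t - h x) * deriv φ t‖ ≤ (v y - v x) * M * |y - x| := by
      refine intervalIntegral.norm_integral_le_of_norm_le_const fun t ht ↦ ?_
      rw [uIoc_of_le hxy] at ht
      rw [norm_mul]
      exact mul_le_mul ((hv x t ht.1.le).trans (by linarith [abs_nonneg (h y - h t), hv t y ht.2]))
        (hφ_deriv t) (norm_nonneg _) ((abs_nonneg _).trans (hv x y hxy))
    have hjump : (h y - h x) * φ y ≤ v y - v x := by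
      refine (le_abs_self _).trans ?_
      rw [abs_mul]
      exact (mul_le_of_le_one_right (abs_nonneg _) (hφ_le y)).trans (hv x y hxy)
    rw [Real.norm_eq_abs, abs_of_nonneg (sub_nonneg.2 hxy)] at hosc
    have hadd := intervalIntegral.integral_add_adjacent_intervals (hint a x) (hint x y)
    linarith [neg_abs_le (∫ t in x..y, (h t - h x) * deriv φ t)]
  have := hanti hab
  simp only [intervalIntegral.integral_same] at this
  linarith

theorem exists_tsupport_subset_Ioo {φ : ℝ → ℝ} (hφ : HasCompactSupport φ) :
    ∃ r : ℝ, 0 < r ∧ tsupport φ ⊆ Ioo (-r) r := by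
  obtain ⟨r, hr, hsub⟩ := hφ.isCompact.isBounded.subset_ball_lt 0 0
  exact ⟨r, hr, by simpa [Real.ball_eq_Ioo] using hsub⟩

theorem variation_le_eVariationOn (h : ℝ → ℝ) : variation h ≤ eVariationOn h univ := by
  by_cases htop : eVariationOn h univ = ⊤
  · exact htop ▸ le_top
  refine iSup₂_le fun φ hφ ↦ iSup₂_le fun hφ_supp hφ_le ↦ ENNReal.ofReal_le_of_le_toReal ?_
  obtain ⟨v, -, hv_mem, hv⟩ := exists_monotone_dist_le_sub htop
  obtain ⟨M, hM⟩ := hφ_supp.deriv.exists_bound_of_continuous hφ.continuous_deriv_one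
  obtain ⟨r, hr_pos, hr⟩ := exists_tsupport_subset_Ioo hφ_supp
  have hsupp : Function.support (fun x ↦ h x * deriv φ x) ⊆ Ioc (-r) r := fun x hx ↦
    Ioo_subset_Ioc_self <| hr <| support_deriv_subset <| right_ne_zero_of_mul hx
  have hle := neg_integral_mul_deriv_le htop
    (fun x y ↦ hv x trivial y trivial) hφ hφ_le hM
    (a := -r) (b := r) (by linarith)
  rw [image_eq_zero_of_notMem_tsupport fun hmem ↦ (hr hmem).2.false,
    image_eq_zero_of_notMem_tsupport fun hmem ↦ (hr hmem).1.false,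
    intervalIntegral.integral_eq_integral_of_support_subset hsupp] at hle
  linarith [(hv_mem r).2, (hv_mem (-r)).1]

end BoundedVariationWeak

section WeakDerivative

variable {f g F : ℝ → ℝ}

theorem continuous_of_eq_add_integral (hg : LocallyIntegrable g)
    (hF : ∀ x, F x = F 0 + ∫ t in (0 : ℝ)..x, g t) : Continuous F := by
  rw [funext hF]
  exact continuous_const.add (intervalIntegral.continuous_primitive
    (fun a b ↦ (hg.integrableOn_isCompact isCompact_uIcc).intervalIntegrable) 0)

theorem hasWeakDeriv_of_eq_add_integral (hg : LocallyIntegrable g)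
    (hF : ∀ x, F x = F 0 + ∫ t in (0 : ℝ)..x, g t) : HasWeakDeriv F g := by
  have hint (a b : ℝ) : IntervalIntegrable g volume a b :=
    (hg.integrableOn_isCompact isCompact_uIcc).intervalIntegrable
  have hderiv : ∀ᵐ x, HasDerivAt F (g x) x := by
    filter_upwards [LocallyIntegrable.ae_hasDerivAt_integral hg] with x hx
    simpa only [← hF] using (hx 0).const_add (F 0)
  refine ⟨(continuous_of_eq_add_integral hg hF).locallyIntegrable, hg, fun φ hφ hφ_supp ↦ ?_⟩
  obtain ⟨r, hr_pos, hr⟩ := exists_tsupport_subset_Ioo hφ_supp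
  have hF_ac : AbsolutelyContinuousOnInterval F (-r) r := by
    rw [funext hF]
    exact (LipschitzWith.const (F 0)).lipschitzOnWith.absolutelyContinuousOnInterval.add <|
      (hint _ _).absolutelyContinuousOnInterval_intervalIntegral (by simp [uIcc_of_le, hr_pos.le])
  have hparts := hF_ac.integral_mul_deriv_eq_deriv_mul hφ.contDiffOn.absolutelyContinuousOnInterval
  have hsupp {ψ k : ℝ → ℝ} (hψ : Function.support ψ ⊆ tsupport φ) :
      Function.support (fun x ↦ k x * ψ x) ⊆ Ioc (-r) r := fun x hx ↦
    Ioo_subset_Ioc_self <| hr <| hψ <| right_ne_zero_of_mul hx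
  rw [image_eq_zero_of_notMem_tsupport fun hmem ↦ (hr hmem).2.false,
    image_eq_zero_of_notMem_tsupport fun hmem ↦ (hr hmem).1.false,
    intervalIntegral.integral_eq_integral_of_support_subset (hsupp support_deriv_subset),
    intervalIntegral.integral_eq_integral_of_support_subset (hsupp (subset_tsupport φ))] at hparts
  rw [hparts, integral_congr_ae (hderiv.mono fun x hx ↦ congrArg (· * φ x) hx.deriv)]
  simp

theorem ae_eq_const_of_hasWeakDeriv_zero (hf : HasWeakDeriv f 0) :
    ∃ a : ℝ, f =ᵐ[volume] fun _ ↦ a := by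
  have hvar : variation f = 0 := by
    refine le_antisymm (iSup₂_le fun φ hφ ↦ iSup₂_le fun hφ_supp _ ↦ ?_) (zero_le)
    simp [← hf.integral_eq φ hφ hφ_supp]
  obtain ⟨k, hfk, hk⟩ := exists_ae_eq_eVariationOn_le_variation hf.locallyIntegrable
    (hvar ▸ ENNReal.zero_ne_top)
  rw [hvar, nonpos_iff_eq_zero, eVariationOn.eq_zero_iff] at hk
  exact ⟨k 0, hfk.trans <| ae_of_all _ fun x ↦ edist_eq_zero.1 (hk x trivial 0 trivial)⟩

theorem HasWeakDeriv.sub {f₁ f₂ g₁ g₂ : ℝ → ℝ} (h₁ : HasWeakDeriv f₁ g₁)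
    (h₂ : HasWeakDeriv f₂ g₂) : HasWeakDeriv (f₁ - f₂) (g₁ - g₂) where
  locallyIntegrable := h₁.locallyIntegrable.sub h₂.locallyIntegrable
  locallyIntegrable_deriv := h₁.locallyIntegrable_deriv.sub h₂.locallyIntegrable_deriv
  integral_eq φ hφ hφ_supp := by
    have hint {h ψ : ℝ → ℝ} (hh : LocallyIntegrable h) (hψ : Continuous ψ)
        (hψ_supp : HasCompactSupport ψ) : Integrable fun x ↦ h x * ψ x :=
      hh.integrable_smul_right_of_hasCompactSupport hψ hψ_supp
    have hφ_deriv := hφ.continuous_deriv_one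
    simp only [Pi.sub_apply, sub_mul]
    rw [integral_sub (hint h₁.locallyIntegrable_deriv hφ.continuous hφ_supp)
        (hint h₂.locallyIntegrable_deriv hφ.continuous hφ_supp),
      integral_sub (hint h₁.locallyIntegrable hφ_deriv hφ_supp.deriv)
        (hint h₂.locallyIntegrable hφ_deriv hφ_supp.deriv),
      h₁.integral_eq φ hφ hφ_supp, h₂.integral_eq φ hφ hφ_supp]
    ring

theorem HasWeakDeriv.exists_ae_eq_integral (hf : HasWeakDeriv f g) :
    ∃ a : ℝ, f =ᵐ[volume] fun x ↦ a + ∫ t in (0 : ℝ)..x, g t := by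
  have hG := hasWeakDeriv_of_eq_add_integral hf.locallyIntegrable_deriv
    (F := fun x ↦ ∫ t in (0 : ℝ)..x, g t) fun x ↦ by simp
  obtain ⟨a, ha⟩ := ae_eq_const_of_hasWeakDeriv_zero (sub_self g ▸ hf.sub hG)
  exact ⟨a, ha.mono fun x hx ↦ sub_eq_iff_eq_add.1 hx⟩

theorem HasWeakDeriv.exists_boundedVariation_primitive (hf : HasWeakDeriv f g)
    (hg : variation g ≠ ⊤) :
    ∃ F k : ℝ → ℝ, f =ᵐ[volume] F ∧ eVariationOn k univ ≤ variation g ∧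
      ∀ x, F x = F 0 + ∫ t in (0 : ℝ)..x, k t := by
  obtain ⟨k, hgk, hk⟩ := exists_ae_eq_eVariationOn_le_variation hf.locallyIntegrable_deriv hg
  obtain ⟨a, hfa⟩ := hf.exists_ae_eq_integral
  refine ⟨_, k, hfa, hk, fun x ↦ ?_⟩
  simp [intervalIntegral.integral_congr_ae (hgk.mono fun _ ht _ ↦ ht)]

theorem variationDeriv_le_mul {C : ℝ} (hC : 0 < C)
    (h : ∀ g, HasWeakDeriv f g → variation g ≠ ⊤ →
      ∃ k, HasWeakDeriv F k ∧ variation k ≤ ENNReal.ofReal C * variation g) :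
    variationDeriv F ≤ ENNReal.ofReal C * variationDeriv f := by
  have hC₀ : ENNReal.ofReal C ≠ 0 := (ENNReal.ofReal_pos.2 hC).ne'
  simp only [variationDeriv, ENNReal.mul_iInf_of_ne hC₀ ENNReal.ofReal_ne_top]
  refine le_iInf₂ fun g hg ↦ ?_
  rcases eq_or_ne (variation g) ⊤ with htop | htop
  · simp [htop, hC₀]
  · obtain ⟨k, hk, hkg⟩ := h g hg htop
    exact iInf₂_le_of_le k hk hkg

end WeakDerivative

theorem monotoneOn_Ioi_of_le_two_mul {β : Type*} [Preorder β] {f : ℝ → β}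
    (hf : ∀ x y, 0 < x → x ≤ y → y ≤ 2 * x → f x ≤ f y) : MonotoneOn f (Ioi 0) := by
  have hpow (n : ℕ) : ∀ x y, 0 < x → x ≤ y → y ≤ 2 ^ n * x → f x ≤ f y := by
    induction n with
    | zero => exact fun x y hx hxy hy ↦ hf x y hx hxy (by linarith)
    | succ n ih =>
      intro x y hx hxy hy
      rw [pow_succ'] at hy
      rcases le_total (y / 2) x with hyx | hxy'
      · exact hf x y hx hxy (by linarith)
      · exact (ih x (y / 2) hx hxy' (by linarith)).trans
          (hf (y / 2) y (by linarith) (by linarith) (by linarith))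
  intro x hx y _ hxy
  obtain ⟨n, hn⟩ := pow_unbounded_of_one_lt (y / x) one_lt_two
  exact hpow n x y hx hxy ((div_lt_iff₀ hx).1 hn).le

section DilationMean

/-- The weighted mean `∫₀¹ w(u) p(x u) du` of the dilations of `p`. With weight `1` it is the
mean value of `p` between `0` and `x`, and with weight `u` and mean values in place of `p` it is
the normalised second primitive. It does not increase the variation. -/
noncomputable def dilationMean (w p : ℝ → ℝ) (x : ℝ) : ℝ :=
  ∫ u in (0 : ℝ)..1, w u * p (x * u)

variable {w p : ℝ → ℝ}

theorem intervalIntegrable_mul_comp_mul (hw : Continuous w) (hp : BoundedVariationOn p univ)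
    (x a b : ℝ) : IntervalIntegrable (fun u ↦ w u * p (x * u)) volume a b := by
  refine IntervalIntegrable.continuousOn_mul ?_ hw.continuousOn
  rcases eq_or_ne x 0 with rfl | hx
  · simp
  · simpa [hx] using (intervalIntegrable_of_boundedVariationOn hp (x * a) (x * b)).comp_mul_left
      (c := x)

theorem eVariationOn_dilationMean_le (hw : Continuous w) (hw_le : ∀ u ∈ Icc 0 1, |w u| ≤ 1)
    (hp : BoundedVariationOn p univ) :
    eVariationOn (dilationMean w p) univ ≤ eVariationOn p univ := by
  have hle : ∀ᵐ u ∂volume.restrict (Ioc (0 : ℝ) 1),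
      eVariationOn (fun x ↦ w u * p (x * u)) univ ≤ eVariationOn p univ := by
    filter_upwards [ae_restrict_mem measurableSet_Ioc] with u hu
    have hlip : LipschitzWith 1 fun y ↦ w u * y := .of_dist_le_mul fun y y' ↦ by
      rw [Real.dist_eq, Real.dist_eq, ← mul_sub, abs_mul, NNReal.coe_one]
      gcongr
      exact hw_le u (Ioc_subset_Icc_self hu)
    calc eVariationOn (fun x ↦ w u * p (x * u)) univ
        ≤ eVariationOn (fun x ↦ p (x * u)) univ := by
          simpa [Function.comp_def] using
            hlip.lipschitzOnWith.comp_eVariationOn_le (mapsTo_univ _ univ)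
      _ ≤ eVariationOn p univ := eVariationOn.comp_le_of_monotoneOn p _
          (fun x _ y _ hxy ↦ mul_le_mul_of_nonneg_right hxy hu.1.le) (mapsTo_univ _ _)
  have hint (x : ℝ) : Integrable (fun u ↦ w u * p (x * u)) (volume.restrict (Ioc 0 1)) :=
    (intervalIntegrable_iff_integrableOn_Ioc_of_le zero_le_one).1
      (intervalIntegrable_mul_comp_mul hw hp x 0 1)
  have hmean : dilationMean w p = fun x ↦ ∫ u in Ioc (0 : ℝ) 1, w u * p (x * u) :=
    funext fun x ↦ intervalIntegral.integral_of_le zero_le_one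
  simpa [hmean] using eVariationOn_integral_le (fun x _ ↦ hint x) hle

theorem mul_dilationMean_one (p : ℝ → ℝ) (x : ℝ) :
    x * dilationMean 1 p x = ∫ t in (0 : ℝ)..x, p t := by
  simp [dilationMean, intervalIntegral.mul_integral_comp_mul_left]

theorem sq_mul_dilationMean_id (p : ℝ → ℝ) (x : ℝ) :
    x ^ 2 * dilationMean id p x = ∫ t in (0 : ℝ)..x, t * p t := by
  have := intervalIntegral.mul_integral_comp_mul_left (f := fun t ↦ t * p t) (a := 0) (b := 1) x
  rw [mul_zero, mul_one] at this
  rw [dilationMean, sq, mul_assoc, ← intervalIntegral.integral_const_mul, ← this]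
  simp [mul_assoc]

theorem sq_mul_dilationMean_id_dilationMean_one (p : ℝ → ℝ) (x : ℝ) :
    x ^ 2 * dilationMean id (dilationMean 1 p) x = ∫ t in (0 : ℝ)..x, ∫ u in (0 : ℝ)..t, p u := by
  simp only [sq_mul_dilationMean_id, mul_dilationMean_one]

theorem dilationMean_nonneg (hw : ∀ u ∈ Icc 0 1, 0 ≤ w u) (hp : 0 ≤ p) (x : ℝ) :
    0 ≤ dilationMean w p x :=
  intervalIntegral.integral_nonneg zero_le_one fun u hu ↦ mul_nonneg (hw u hu) (hp _)

theorem dilationMean_id_dilationMean_one_le (hp : BoundedVariationOn p univ) (hp₀ : 0 ≤ p)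
    (x : ℝ) : dilationMean id (dilationMean 1 p) x ≤ dilationMean 1 p x := by
  have hmean : BoundedVariationOn (dilationMean 1 p) univ :=
    ((eVariationOn_dilationMean_le continuous_one (by simp) hp).trans_lt hp.lt_top).ne
  have hle (u : ℝ) (hu : u ∈ Icc (0 : ℝ) 1) :
      u * dilationMean 1 p (x * u) ≤ dilationMean 1 p x := by
    have hsub := intervalIntegral.mul_integral_comp_mul_left (f := fun t ↦ p (x * t))
      (a := 0) (b := 1) u
    simp only [mul_zero, mul_one, ← mul_assoc] at hsub
    simp only [dilationMean, Pi.one_apply, one_mul, hsub]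
    refine intervalIntegral.integral_mono_interval le_rfl hu.1 hu.2
      (ae_of_all _ fun t ↦ hp₀ (x * t)) ?_
    simpa using intervalIntegrable_mul_comp_mul continuous_one hp x 0 1
  simpa [dilationMean] using intervalIntegral.integral_mono_on zero_le_one
    (intervalIntegrable_mul_comp_mul continuous_id hmean x 0 1)
    (intervalIntegrable_const (c := dilationMean 1 p x)) hle

theorem exists_monotone_abs_dilationMean_sub_le {V : ℝ}
    (hp : eVariationOn p univ ≤ ENNReal.ofReal V) (hV : 0 ≤ V) :
    ∃ v : ℝ → ℝ, Monotone v ∧ (∀ x, v x ∈ Icc 0 (2 * V)) ∧ ∀ x y, x ≤ y →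
      |dilationMean 1 p y - dilationMean 1 p x| +
        |dilationMean id (dilationMean 1 p) y - dilationMean id (dilationMean 1 p) x| ≤
          v y - v x := by
  have hbv {g : ℝ → ℝ} (hg : eVariationOn g univ ≤ ENNReal.ofReal V) : BoundedVariationOn g univ :=
    (hg.trans_lt ENNReal.ofReal_lt_top).ne
  have hA : eVariationOn (dilationMean 1 p) univ ≤ ENNReal.ofReal V :=
    (eVariationOn_dilationMean_le continuous_one (by simp) (hbv hp)).trans hp
  have hB : eVariationOn (dilationMean id (dilationMean 1 p)) univ ≤ ENNReal.ofReal V :=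
    (eVariationOn_dilationMean_le continuous_id
      (fun u hu ↦ (abs_of_nonneg hu.1).trans_le hu.2) (hbv hA)).trans hA
  obtain ⟨v, hv, hvV, hAv⟩ := exists_monotone_dist_le_sub (hbv hA)
  obtain ⟨w, hw, hwV, hBw⟩ := exists_monotone_dist_le_sub (hbv hB)
  refine ⟨v + w, hv.add hw, fun x ↦ ⟨add_nonneg (hvV x).1 (hwV x).1, ?_⟩, fun x y hxy ↦ ?_⟩
  · rw [two_mul]
    exact add_le_add ((hvV x).2.trans (ENNReal.toReal_le_of_le_ofReal hV hA))
      ((hwV x).2.trans (ENNReal.toReal_le_of_le_ofReal hV hB))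
  · have hvw := add_le_add (hAv x trivial y trivial hxy) (hBw x trivial y trivial hxy)
    rwa [← add_sub_add_comm] at hvw

end DilationMean

section Optimality

/- In the application `α` and `β` are the mean and the iterated mean at `x` of the derivative of
`F 0 - F`, and `γ` and `η` are those of `t ↦ F 0 - F (-t)` at `s x`, while `r = s x / x`. Primed
variables belong to `x'`. -/
variable {α α' β β' γ γ' η η' r r' c x x' : ℝ}

theorem mul_ratio_sub_le_of_optimality (hηγ : η ≤ γ) (hr' : 0 ≤ r') (hr'c : r' ≤ c)
    (hrr' : r' ≤ r) (h : γ * r + (γ - η) * r ^ 2 = β) (h' : γ' * r' + (γ' - η') * r' ^ 2 = β') :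
    γ * (r - r') ≤ |β' - β| + (c + c ^ 2) * |γ' - γ| + c ^ 2 * |η' - η| := by
  have hdecomp : γ * (r - r') + (γ - η) * (r ^ 2 - r' ^ 2) =
      β - β' + (r' + r' ^ 2) * (γ' - γ) + r' ^ 2 * (η - η') := by
    rw [← h, ← h']; ring
  calc γ * (r - r') ≤ γ * (r - r') + (γ - η) * (r ^ 2 - r' ^ 2) :=
        le_add_of_nonneg_right (mul_nonneg (by linarith) (by nlinarith))
    _ = β - β' + (r' + r' ^ 2) * (γ' - γ) + r' ^ 2 * (η - η') := hdecomp
    _ ≤ |β' - β| + (r' + r' ^ 2) * |γ' - γ| + r' ^ 2 * |η' - η| := by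
        rw [abs_sub_comm β', abs_sub_comm η']
        gcongr <;> exact le_abs_self _
    _ ≤ |β' - β| + (c + c ^ 2) * |γ' - γ| + c ^ 2 * |η' - η| := by gcongr

theorem mean_mul_ratio_sub_le (hx : 0 < x) (hxx' : x ≤ x') (hx' : x' ≤ 2 * x) (hβ : 0 ≤ β)
    (hrc : r ≤ c) (hr₀ : 0 ≤ r) (hrr' : r' ≤ r) (hs : x * r ≤ x' * r')
    (hint : α * x * (x' - x) ≤ β' * x' ^ 2 - β * x ^ 2) :
    α * (r - r') ≤ 2 * c * |β' - β| + 3 * (β * (r - r')) := by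
  have hδ : 0 ≤ r - r' := sub_nonneg.2 hrr'
  rcases hxx'.eq_or_lt with rfl | hlt
  · have : r - r' = 0 := le_antisymm (by nlinarith) hδ
    rw [this]
    have hc : 0 ≤ c := hr₀.trans hrc
    simp only [mul_zero, add_zero]
    positivity
  have hδx' : (r - r') * x' ≤ c * (x' - x) := by nlinarith
  have hΔβ : (β' - β) * (r - r') * x' ^ 2 ≤ |β' - β| * (c * (x' - x)) * (2 * x) := by
    calc (β' - β) * (r - r') * x' ^ 2
        ≤ |β' - β| * (r - r') * x' ^ 2 := by gcongr; exact le_abs_self _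
      _ = |β' - β| * ((r - r') * x') * x' := by ring
      _ ≤ |β' - β| * (c * (x' - x)) * (2 * x) := by
          have hx'_nonneg : 0 ≤ x' := hx.le.trans hxx'
          have hΔ : 0 ≤ c * (x' - x) := (mul_nonneg hδ hx'_nonneg).trans hδx'
          gcongr
  have hβδ : β * (r - r') * (x' ^ 2 - x ^ 2) ≤ β * (r - r') * (3 * (x * (x' - x))) := by
    gcongr
    nlinarith
  refine le_of_mul_le_mul_right ?_ (mul_pos hx (sub_pos.2 hlt))
  linarith [mul_le_mul_of_nonneg_right hint hδ]

theorem slope_sub_le (hγ : 0 ≤ γ) (hα : 0 ≤ α) (hr : 0 ≤ r) (hr' : 0 ≤ r') :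
    (α' - r' * γ') / (1 + r') - (α - r * γ) / (1 + r) ≤
      |α' - α| + |γ' - γ| + (α + γ) * max (r - r') 0 := by
  have hdecomp : (α' - r' * γ') / (1 + r') - (α - r * γ) / (1 + r) =
      (α' - α) * (1 / (1 + r')) + (γ - γ') * (r' / (1 + r')) +
        (α + γ) * ((r - r') / ((1 + r) * (1 + r'))) := by
    field_simp
    ring
  rw [hdecomp, abs_sub_comm γ']
  have hmul {a b : ℝ} (hb : 0 ≤ b) (hb₁ : b ≤ 1) : a * b ≤ |a| :=
    (mul_le_mul_of_nonneg_right (le_abs_self a) hb).trans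
      (mul_le_of_le_one_right (abs_nonneg a) hb₁)
  gcongr ?_ + ?_ + (α + γ) * ?_
  · exact hmul (by positivity) ((div_le_one (by positivity)).2 (by linarith))
  · exact hmul (by positivity) ((div_le_one (by positivity)).2 (by linarith))
  · calc (r - r') / ((1 + r) * (1 + r')) ≤ max (r - r') 0 / ((1 + r) * (1 + r')) := by
          gcongr
          exact le_max_left _ _
      _ ≤ max (r - r') 0 := div_le_self (le_max_right _ _) (by nlinarith)

/-- The constant by which the upward variation of the slope is controlled in
`slope_sub_le_of_optimality`. -/
def slopeConst (c : ℝ) : ℝ :=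
  2 * c + (1 + 3 * (c + c ^ 2)) * (1 + (c + c ^ 2))

theorem slopeConst_nonneg (hc : 0 ≤ c) : 0 ≤ slopeConst c := by
  unfold slopeConst
  positivity

theorem slope_sub_le_of_optimality (hx : 0 < x) (hxx' : x ≤ x') (hx' : x' ≤ 2 * x)
    (hα : 0 ≤ α) (hη : 0 ≤ η) (hηγ : η ≤ γ) (hr : r ∈ Icc 0 c) (hr' : r' ∈ Icc 0 c)
    (hs : x * r ≤ x' * r') (h : γ * r + (γ - η) * r ^ 2 = β)
    (h' : γ' * r' + (γ' - η') * r' ^ 2 = β')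
    (hint : α * x * (x' - x) ≤ β' * x' ^ 2 - β * x ^ 2) :
    (α' - r' * γ') / (1 + r') - (α - r * γ) / (1 + r) ≤
      slopeConst c * (|α' - α| + |β' - β| + |γ' - γ| + |η' - η|) := by
  unfold slopeConst
  have hc : 0 ≤ c := hr.1.trans hr.2
  have hγ : 0 ≤ γ := hη.trans hηγ
  have hslope := slope_sub_le (α' := α') (γ' := γ') hγ hα hr.1 hr'.1
  set d := c + c ^ 2
  have : 0 ≤ d := by positivity
  have hδ : (α + γ) * max (r - r') 0 ≤ 2 * c * |β' - β| +
      (1 + 3 * d) * (|β' - β| + d * |γ' - γ| + d * |η' - η|) := by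
    rcases le_total r r' with hle | hrr'
    · rw [max_eq_right (sub_nonpos.2 hle), mul_zero]
      positivity
    have hγδ := mul_ratio_sub_le_of_optimality hηγ hr'.1 hr'.2 hrr' h h'
    have hβ : 0 ≤ β := h ▸ add_nonneg (mul_nonneg hγ hr.1) (by nlinarith [sq_nonneg r])
    have hβd : β ≤ d * γ := by
      calc β = γ * r + (γ - η) * r ^ 2 := h.symm
        _ ≤ γ * c + γ * c ^ 2 := by
          gcongr
          exacts [hr.2, sub_le_self γ hη, hr.1, hr.2]
        _ = d * γ := by ring
    have hαδ := mean_mul_ratio_sub_le hx hxx' hx' hβ hr.2 hr.1 hrr' hs hint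
    calc (α + γ) * max (r - r') 0 = α * (r - r') + γ * (r - r') := by
          rw [max_eq_left (sub_nonneg.2 hrr')]; ring
      _ ≤ 2 * c * |β' - β| + 3 * (d * γ * (r - r')) + γ * (r - r') := by
          linarith [mul_le_mul_of_nonneg_right hβd (sub_nonneg.2 hrr')]
      _ = 2 * c * |β' - β| + (1 + 3 * d) * (γ * (r - r')) := by ring
      _ ≤ 2 * c * |β' - β| + (1 + 3 * d) * (|β' - β| + d * |γ' - γ| + d * |η' - η|) := by
          gcongr
          refine hγδ.trans ?_
          gcongr
          exact le_add_of_nonneg_left hc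
  have hslack : 0 ≤ (2 * c + 4 * d + 3 * d ^ 2) * |α' - α| + (1 + 3 * d) * d * |β' - β| +
      (2 * c + 3 * d) * |γ' - γ| + (2 * c + 1 + 3 * d) * |η' - η| := by positivity
  linarith

end Optimality

theorem mul_sub_le_integral_of_monotone {P : ℝ → ℝ} (hP : Monotone P) (x y : ℝ) :
    P x * (y - x) ≤ ∫ t in x..y, P t := by
  rcases le_total x y with hxy | hyx
  · simpa [mul_comm] using intervalIntegral.integral_mono_on hxy
      (intervalIntegrable_const (μ := volume) (c := P x)) hP.intervalIntegrable fun t ht ↦ hP ht.1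
  · have := intervalIntegral.integral_mono_on hyx hP.intervalIntegrable
      (intervalIntegrable_const (μ := volume) (c := P x)) fun t ht ↦ hP ht.2
    rw [intervalIntegral.integral_symm]
    simp only [intervalIntegral.integral_const, smul_eq_mul] at this
    linarith

section HalfLineMin

/-- `N x` is the minimum over `t ≥ 0` of `(∫₀ᵗ Q + ∫₀ˣ P) / (t + x)`, attained at `t = s x`.
For `P x = f 0 - f x`, `Q t = f 0 - f (-t)` and `N x = f 0 - M f x` this is the optimality of the
interval `[-s x, x]` in the definition of `M f x`. -/
structure IsHalfLineMin (P Q N s : ℝ → ℝ) : Prop where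
  nonneg : ∀ x, 0 < x → 0 ≤ s x
  mul_add_eq : ∀ x, 0 < x →
    N x * (s x + x) = (∫ t in (0 : ℝ)..s x, Q t) + ∫ t in (0 : ℝ)..x, P t
  mul_add_le : ∀ x, 0 < x → ∀ t, 0 ≤ t →
    N x * (t + x) ≤ (∫ u in (0 : ℝ)..t, Q u) + ∫ u in (0 : ℝ)..x, P u

namespace IsHalfLineMin

variable {P Q N s : ℝ → ℝ} {x y : ℝ}

theorem congr {P' Q' : ℝ → ℝ} (h : IsHalfLineMin P Q N s) (hP : EqOn P P' (Ici 0))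
    (hQ : EqOn Q Q' (Ici 0)) : IsHalfLineMin P' Q' N s := by
  have hint {f g : ℝ → ℝ} (hfg : EqOn f g (Ici 0)) (a : ℝ) (ha : 0 ≤ a) :
      ∫ t in (0 : ℝ)..a, f t = ∫ t in (0 : ℝ)..a, g t :=
    intervalIntegral.integral_congr fun t ht ↦ hfg (uIcc_of_le ha ▸ ht).1
  refine ⟨h.nonneg, fun x hx ↦ ?_, fun x hx t ht ↦ ?_⟩
  · rw [← hint hQ _ (h.nonneg x hx), ← hint hP x hx.le, h.mul_add_eq x hx]
  · rw [← hint hQ t ht, ← hint hP x hx.le]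
    exact h.mul_add_le x hx t ht

theorem apply_eq (h : IsHalfLineMin P Q N s) (hQ : Monotone Q) (hQ_cont : Continuous Q)
    (hP₀ : ∀ x, 0 ≤ x → 0 ≤ P x) (hQ₀ : Q 0 = 0) (hx : 0 < x) : Q (s x) = N x := by
  have hle (t : ℝ) (ht : 0 ≤ t) : N x * (t - s x) ≤ Q t * (t - s x) := by
    have hQ_int := mul_sub_le_integral_of_monotone hQ t (s x)
    rw [← intervalIntegral.integral_interval_sub_left hQ.intervalIntegrable
      hQ.intervalIntegrable (a := 0)] at hQ_int
    linarith [h.mul_add_eq x hx, h.mul_add_le x hx t ht]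
  apply le_antisymm
  · rcases (h.nonneg x hx).eq_or_lt with hs | hs
    · have hJ : 0 ≤ ∫ t in (0 : ℝ)..x, P t :=
        intervalIntegral.integral_nonneg hx.le fun t ht ↦ hP₀ t ht.1
      have := h.mul_add_eq x hx
      rw [← hs, intervalIntegral.integral_same, zero_add, zero_add] at this
      rw [← hs, hQ₀]
      exact nonneg_of_mul_nonneg_left (this ▸ hJ) hx
    · refine le_of_tendsto (hQ_cont.continuousWithinAt (s := Iio (s x))) ?_
      filter_upwards [Ioo_mem_nhdsLT hs] with t ht
      exact (mul_le_mul_right_of_neg (sub_neg.2 ht.2)).1 (hle t ht.1.le)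
  · refine ge_of_tendsto (hQ_cont.continuousWithinAt (s := Ioi (s x))) ?_
    filter_upwards [self_mem_nhdsWithin] with t ht
    exact le_of_mul_le_mul_right (hle t ((h.nonneg x hx).trans (le_of_lt ht))) (sub_pos.2 ht)

theorem sub_mul_le (h : IsHalfLineMin P Q N s) (hP : Monotone P) (hx : 0 < x) (hy : 0 < y) :
    (N y - N x) * (s x + y) ≤ ∫ t in x..y, (P t - N x) := by
  rw [intervalIntegral.integral_sub hP.intervalIntegrable intervalIntegrable_const,
    ← intervalIntegral.integral_interval_sub_left hP.intervalIntegrable hP.intervalIntegrable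
      (a := 0), intervalIntegral.integral_const, smul_eq_mul]
  linarith [h.mul_add_eq x hx, h.mul_add_le y hy (s x) (h.nonneg x hx)]

theorem le_sub_mul (h : IsHalfLineMin P Q N s) (hP : Monotone P) (hx : 0 < x) (hy : 0 < y) :
    ∫ t in x..y, (P t - N x) ≤ (N y - N x) * (s y + y) := by
  rw [intervalIntegral.integral_sub hP.intervalIntegrable intervalIntegrable_const,
    ← intervalIntegral.integral_interval_sub_left hP.intervalIntegrable hP.intervalIntegrable
      (a := 0), intervalIntegral.integral_const, smul_eq_mul]
  linarith [h.mul_add_eq y hy, h.mul_add_le x hx (s y) (h.nonneg y hy)]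

theorem apply_le (h : IsHalfLineMin P Q N s) (hP : Monotone P) (hx : 0 < x) : N x ≤ P x := by
  have hJ := mul_sub_le_integral_of_monotone hP x 0
  have hmin := h.mul_add_le x hx 0 le_rfl
  rw [intervalIntegral.integral_same, zero_add, zero_add] at hmin
  rw [intervalIntegral.integral_symm] at hJ
  exact le_of_mul_le_mul_right (by linarith) hx

theorem monotoneOn (h : IsHalfLineMin P Q N s) (hP : Monotone P) :
    MonotoneOn N (Ioi 0) := by
  intro x hx y hy hxy
  have hw : 0 ≤ ∫ t in x..y, (P t - N x) := intervalIntegral.integral_nonneg hxy fun t ht ↦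
    sub_nonneg.2 ((h.apply_le hP hx).trans (hP ht.1))
  exact sub_nonneg.1 <| nonneg_of_mul_nonneg_left (hw.trans (h.le_sub_mul hP hx hy))
    (add_pos_of_nonneg_of_pos (h.nonneg y hy) hy)

theorem exists_monotoneOn (h : IsHalfLineMin P Q N s) (hP : Monotone P)
    (hQ : Monotone Q) (hQ_cont : Continuous Q) (hQs : ∀ x, 0 < x → Q (s x) = N x) :
    ∃ s' : ℝ → ℝ, IsHalfLineMin P Q N s' ∧ MonotoneOn s' (Ioi 0) ∧ ∀ x, 0 < x → s' x ≤ s x := by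
  let A (x : ℝ) : Set ℝ := {t | 0 ≤ t ∧ N x ≤ Q t}
  have hA_bdd (x : ℝ) : BddBelow (A x) := ⟨0, fun t ht ↦ ht.1⟩
  have hsA (x : ℝ) (hx : 0 < x) : s x ∈ A x := ⟨h.nonneg x hx, (hQs x hx).ge⟩
  have hmem (x : ℝ) (hx : 0 < x) : sInf (A x) ∈ A x :=
    ((isClosed_Ici (a := (0 : ℝ))).inter (isClosed_Ici.preimage hQ_cont)).csInf_mem
      ⟨s x, hsA x hx⟩ (hA_bdd x)
  have hle (x : ℝ) (hx : 0 < x) : sInf (A x) ≤ s x := csInf_le (hA_bdd x) (hsA x hx)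
  refine ⟨fun x ↦ sInf (A x), ⟨fun x hx ↦ (hmem x hx).1, fun x hx ↦ ?_, h.mul_add_le⟩,
    fun x hx y hy hxy ↦ ?_, hle⟩
  · refine le_antisymm (h.mul_add_le x hx _ (hmem x hx).1) ?_
    have hint := mul_sub_le_integral_of_monotone hQ (sInf (A x)) (s x)
    rw [← intervalIntegral.integral_interval_sub_left hQ.intervalIntegrable
      hQ.intervalIntegrable (a := 0)] at hint
    linarith [h.mul_add_eq x hx,
      mul_le_mul_of_nonneg_right (hmem x hx).2 (sub_nonneg.2 (hle x hx))]
  · exact csInf_le_csInf (hA_bdd x) ⟨s y, hsA y hy⟩ fun t ht ↦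
      ⟨ht.1, (h.monotoneOn hP hx hy hxy).trans ht.2⟩

theorem continuousOn (h : IsHalfLineMin P Q N s) (hP : Monotone P) (hP_cont : Continuous P) :
    ContinuousOn N (Ioi 0) := by
  intro x hx
  have hw : Tendsto (fun y ↦ |∫ t in x..y, (P t - N x)| / y) (𝓝 x) (𝓝 0) := by
    have hcont : Continuous fun y ↦ ∫ t in x..y, (P t - N x) :=
      intervalIntegral.continuous_primitive
        (fun _ _ ↦ (hP_cont.sub continuous_const).intervalIntegrable _ _) x
    have hquot : ContinuousAt (fun y ↦ |∫ t in x..y, (P t - N x)| / y) x :=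
      hcont.abs.continuousAt.div continuousAt_id (ne_of_gt hx)
    simpa using hquot.tendsto
  refine ContinuousAt.continuousWithinAt (tendsto_iff_dist_tendsto_zero.2 ?_)
  refine squeeze_zero' (Eventually.of_forall fun _ ↦ dist_nonneg) ?_ hw
  filter_upwards [Ioi_mem_nhds hx] with y hy
  rw [Real.dist_eq, le_div_iff₀ hy]
  have hsx := h.nonneg x hx
  have hsy := h.nonneg y hy
  rcases le_total 0 (N y - N x) with hle | hle
  · rw [abs_of_nonneg hle]
    exact (mul_le_mul_of_nonneg_left (le_add_of_nonneg_left hsx) hle).trans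
      ((h.sub_mul_le hP hx hy).trans (le_abs_self _))
  · rw [abs_of_nonpos hle]
    linarith [neg_le_abs (∫ t in x..y, (P t - N x)), h.le_sub_mul hP hx hy,
      mul_nonneg_of_nonpos_of_nonpos hle (neg_nonpos.2 hsy)]

theorem slope_mem_uIcc (h : IsHalfLineMin P Q N s) (hP : Monotone P) (hx : 0 < x) (hy : 0 < y)
    (hyx : y ≠ x) :
    slope N x y ∈ uIcc ((∫ t in x..y, (P t - N x)) / (y - x) / (y + s y))
      ((∫ t in x..y, (P t - N x)) / (y - x) / (y + s x)) := by
  have hle : N y - N x ≤ (∫ t in x..y, (P t - N x)) / (y + s x) := by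
    rw [le_div_iff₀ (add_pos_of_pos_of_nonneg hy (h.nonneg x hx)), add_comm y]
    exact h.sub_mul_le hP hx hy
  have hge : (∫ t in x..y, (P t - N x)) / (y + s y) ≤ N y - N x := by
    rw [div_le_iff₀ (add_pos_of_pos_of_nonneg hy (h.nonneg y hy)), add_comm y]
    exact h.le_sub_mul hP hx hy
  rw [slope_def_field, mem_uIcc, div_right_comm, div_right_comm _ _ (y + s x)]
  rcases lt_or_gt_of_ne hyx with hlt | hgt
  · exact .inr ⟨div_le_div_of_nonpos_of_le (sub_neg.2 hlt).le hle,
      div_le_div_of_nonpos_of_le (sub_neg.2 hlt).le hge⟩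
  · exact .inl ⟨div_le_div_of_nonneg_right hge (sub_pos.2 hgt).le,
      div_le_div_of_nonneg_right hle (sub_pos.2 hgt).le⟩

theorem hasDerivAt (h : IsHalfLineMin P Q N s) (hP : Monotone P) (hP_cont : Continuous P)
    (hx : 0 < x) (hs : ContinuousAt s x) : HasDerivAt N ((P x - N x) / (x + s x)) x := by
  have hw : Tendsto (fun y ↦ (∫ t in x..y, (P t - N x)) / (y - x)) (𝓝[≠] x) (𝓝 (P x - N x)) := by
    have hderiv :=
      ((hP_cont.sub (continuous_const (y := N x))).integral_hasStrictDerivAt x x).hasDerivAt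
    simpa [slope_fun_def_field] using hasDerivAt_iff_tendsto_slope.1 hderiv
  have hquot {r : ℝ → ℝ} (hr : ContinuousAt r x) (hrx : r x = s x) :
      Tendsto (fun y ↦ (∫ t in x..y, (P t - N x)) / (y - x) / (y + r y)) (𝓝[≠] x)
        (𝓝 ((P x - N x) / (x + s x))) :=
    hw.div (hrx ▸ (continuousAt_id.add hr).tendsto.mono_left nhdsWithin_le_nhds)
      (add_pos_of_pos_of_nonneg hx (h.nonneg x hx)).ne'
  have hlower := hquot hs rfl
  have hupper := hquot (continuousAt_const (y := s x)) rfl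
  have hmin := hlower.min hupper
  have hmax := hlower.max hupper
  rw [min_self] at hmin
  rw [max_self] at hmax
  have hmem : ∀ᶠ y in 𝓝[≠] x, slope N x y ∈ uIcc
      ((∫ t in x..y, (P t - N x)) / (y - x) / (y + s y))
      ((∫ t in x..y, (P t - N x)) / (y - x) / (y + s x)) := by
    filter_upwards [self_mem_nhdsWithin, mem_nhdsWithin_of_mem_nhds (Ioi_mem_nhds hx)]
      with y hyx hy using h.slope_mem_uIcc hP hx hy hyx
  exact hasDerivAt_iff_tendsto_slope.2 <| tendsto_of_tendsto_of_tendsto_of_le_of_le' hmin hmax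
    (hmem.mono fun y hy ↦ hy.1) (hmem.mono fun y hy ↦ hy.2)

theorem eq_integral (h : IsHalfLineMin P Q N s) (hP : Monotone P) (hP_cont : Continuous P)
    (hP₀ : P 0 = 0) (hN₀ : N 0 = 0) (hN : ∀ x, 0 < x → 0 ≤ N x) (hs : MonotoneOn s (Ioi 0))
    {k : ℝ → ℝ} (hk : ∀ x, 0 < x → k x = (P x - N x) / (x + s x))
    (hk_int : IntervalIntegrable k volume 0 y) (hy : 0 ≤ y) : N y = ∫ t in (0 : ℝ)..y, k t := by
  have hN_cont : ContinuousOn N (Icc 0 y) := by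
    intro x hx
    rcases hx.1.eq_or_lt with rfl | hx₀
    · have hP_lim : Tendsto P (𝓝[Icc 0 y] 0) (𝓝 0) := by
        simpa [ContinuousWithinAt, hP₀] using hP_cont.continuousWithinAt (s := Icc 0 y) (x := 0)
      have hbound (z : ℝ) (hz : z ∈ Icc 0 y) : 0 ≤ N z ∧ N z ≤ P z := by
        rcases hz.1.eq_or_lt with rfl | hz₀
        · simp [hN₀, hP₀]
        · exact ⟨hN z hz₀, h.apply_le hP hz₀⟩
      rw [ContinuousWithinAt, hN₀]
      exact tendsto_of_tendsto_of_tendsto_of_le_of_le' tendsto_const_nhds hP_lim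
        (eventually_mem_nhdsWithin.mono fun z hz ↦ (hbound z hz).1)
        (eventually_mem_nhdsWithin.mono fun z hz ↦ (hbound z hz).2)
    · exact ((h.continuousOn hP hP_cont).continuousAt (Ioi_mem_nhds hx₀)).continuousWithinAt
  have hderiv : ∀ x ∈ Ioo 0 y \ {x ∈ Ioi 0 | ¬ContinuousWithinAt s (Ioi 0) x},
      HasDerivAt N (k x) x := fun x ⟨hx, hsx⟩ ↦ by
    rw [hk x hx.1]
    refine h.hasDerivAt hP hP_cont hx.1 ?_
    exact (not_not.1 fun hsc ↦ hsx ⟨hx.1, hsc⟩).continuousAt (Ioi_mem_nhds hx.1)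
  rw [integral_eq_of_hasDerivAt_off_countable_of_le N k hy hs.countable_not_continuousWithinAt
    hN_cont hderiv hk_int, hN₀, sub_zero]

end IsHalfLineMin

section SlopeVariation

theorem monotone_integral_of_nonneg {p : ℝ → ℝ} (hp : ∀ a b, IntervalIntegrable p volume a b)
    (hp₀ : 0 ≤ p) : Monotone fun x ↦ ∫ t in (0 : ℝ)..x, p t := fun x y hxy ↦ by
  rw [← sub_nonneg, intervalIntegral.integral_interval_sub_left (hp 0 y) (hp 0 x)]
  exact intervalIntegral.integral_nonneg hxy fun t _ ↦ hp₀ t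

variable {p q N s : ℝ → ℝ} {c x y V B : ℝ}

theorem IsHalfLineMin.slope_sub_le
    (h : IsHalfLineMin (fun x ↦ ∫ t in (0 : ℝ)..x, p t) (fun x ↦ ∫ t in (0 : ℝ)..x, q t) N s)
    (hp : BoundedVariationOn p univ) (hq : BoundedVariationOn q univ) (hp₀ : 0 ≤ p) (hq₀ : 0 ≤ q)
    (hs : MonotoneOn s (Ioi 0)) (hsc : ∀ x, 0 < x → s x ≤ c * x)
    (hN : ∀ x, 0 < x → ∫ t in (0 : ℝ)..s x, q t = N x)
    (hx : 0 < x) (hxy : x ≤ y) (hyx : y ≤ 2 * x) :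
    ((∫ t in (0 : ℝ)..y, p t) - N y) / (y + s y) - ((∫ t in (0 : ℝ)..x, p t) - N x) / (x + s x) ≤
      slopeConst c * (|dilationMean 1 p y - dilationMean 1 p x| +
        |dilationMean id (dilationMean 1 p) y - dilationMean id (dilationMean 1 p) x| +
        |dilationMean 1 q (s y) - dilationMean 1 q (s x)| +
        |dilationMean id (dilationMean 1 q) (s y) - dilationMean id (dilationMean 1 q) (s x)|) := by
  have hy : 0 < y := hx.trans_le hxy
  have hopt (z : ℝ) (hz : 0 < z) : dilationMean 1 q (s z) * (s z / z) +
      (dilationMean 1 q (s z) - dilationMean id (dilationMean 1 q) (s z)) * (s z / z) ^ 2 =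
      dilationMean id (dilationMean 1 p) z := by
    have hmin := h.mul_add_eq z hz
    rw [← hN z hz, ← mul_dilationMean_one, ← sq_mul_dilationMean_id_dilationMean_one,
      ← sq_mul_dilationMean_id_dilationMean_one] at hmin
    field_simp
    linarith
  have hslope (z : ℝ) (hz : 0 < z) : ((∫ t in (0 : ℝ)..z, p t) - N z) / (z + s z) =
      (dilationMean 1 p z - s z / z * dilationMean 1 q (s z)) / (1 + s z / z) := by
    rw [← hN z hz, ← mul_dilationMean_one, ← mul_dilationMean_one]
    field_simp
  have hratio (z : ℝ) (hz : 0 < z) : s z / z ∈ Icc 0 c :=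
    ⟨div_nonneg (h.nonneg z hz) hz.le, (div_le_iff₀ hz).2 (hsc z hz)⟩
  rw [hslope x hx, hslope y hy]
  refine slope_sub_le_of_optimality hx hxy hyx
    (dilationMean_nonneg (by simp) hp₀ x)
    (dilationMean_nonneg (fun u hu ↦ hu.1) (dilationMean_nonneg (by simp) hq₀) (s x))
    (dilationMean_id_dilationMean_one_le hq hq₀ (s x)) (hratio x hx) (hratio y hy) ?_
    (hopt x hx) (hopt y hy) ?_
  · rw [mul_div_cancel₀ _ hx.ne', mul_div_cancel₀ _ hy.ne']
    exact hs hx hy hxy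
  · have hP_mono := monotone_integral_of_nonneg (intervalIntegrable_of_boundedVariationOn hp) hp₀
    have hint := mul_sub_le_integral_of_monotone hP_mono x y
    rw [← intervalIntegral.integral_interval_sub_left hP_mono.intervalIntegrable
      hP_mono.intervalIntegrable (a := 0), ← sq_mul_dilationMean_id_dilationMean_one,
      ← sq_mul_dilationMean_id_dilationMean_one, ← mul_dilationMean_one] at hint
    linarith

theorem IsHalfLineMin.eVariationOn_slope_le
    (h : IsHalfLineMin (fun x ↦ ∫ t in (0 : ℝ)..x, p t) (fun x ↦ ∫ t in (0 : ℝ)..x, q t) N s)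
    (hp : eVariationOn p univ ≤ ENNReal.ofReal V) (hq : eVariationOn q univ ≤ ENNReal.ofReal V)
    (hV : 0 ≤ V) (hp₀ : 0 ≤ p) (hq₀ : 0 ≤ q)
    (hs : MonotoneOn s (Ioi 0)) (hsc : ∀ x, 0 < x → s x ≤ c * x) (hc : 0 ≤ c)
    (hN : ∀ x, 0 < x → ∫ t in (0 : ℝ)..s x, q t = N x)
    (hB : MapsTo (fun x ↦ ((∫ t in (0 : ℝ)..x, p t) - N x) / (x + s x)) (Ioi 0) (Icc 0 B)) :
    eVariationOn (fun x ↦ ((∫ t in (0 : ℝ)..x, p t) - N x) / (x + s x)) (Ioi 0) ≤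
      ENNReal.ofReal (B + 2 * (slopeConst c * (4 * V))) := by
  have hK := slopeConst_nonneg hc
  have hp_bv : BoundedVariationOn p univ := (hp.trans_lt ENNReal.ofReal_lt_top).ne
  have hq_bv : BoundedVariationOn q univ := (hq.trans_lt ENNReal.ofReal_lt_top).ne
  obtain ⟨v, hv, hvV, hpv⟩ := exists_monotone_abs_dilationMean_sub_le hp hV
  obtain ⟨w, hw, hwV, hqw⟩ := exists_monotone_abs_dilationMean_sub_le hq hV
  set m : ℝ → ℝ := fun x ↦ ((∫ t in (0 : ℝ)..x, p t) - N x) / (x + s x)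
  set S : ℝ → ℝ := fun x ↦ slopeConst c * (v x + w (s x))
  have hS_sub : MonotoneOn (fun x ↦ S x - m x) (Ioi 0) :=
    monotoneOn_Ioi_of_le_two_mul fun x y hx hxy hyx ↦ by
      have hm := h.slope_sub_le hp_bv hq_bv hp₀ hq₀ hs hsc hN hx hxy hyx
      have hsum := mul_le_mul_of_nonneg_left
        (add_le_add (hpv x y hxy) (hqw _ _ (hs hx (hx.trans_le hxy) hxy))) hK
      simp only [S, m]
      linarith
  refine eVariationOn_le_of_sub_le_sub (S := S) hB (fun x hx y hy hxy ↦ ?_) (fun x _ ↦ ⟨?_, ?_⟩)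
    fun x hx y hy hxy ↦ by linarith [hS_sub hx hy hxy]
  · exact mul_le_mul_of_nonneg_left (add_le_add (hv hxy) (hw (hs hx hy hxy))) hK
  · exact mul_nonneg hK (add_nonneg (hvV x).1 (hwV (s x)).1)
  · exact mul_le_mul_of_nonneg_left (by linarith [(hvV x).2, (hwV (s x)).2]) hK

theorem IsHalfLineMin.exists_eq_integral
    (h : IsHalfLineMin (fun x ↦ ∫ t in (0 : ℝ)..x, p t) (fun x ↦ ∫ t in (0 : ℝ)..x, q t) N s)
    (hp : eVariationOn p univ ≤ ENNReal.ofReal V) (hq : eVariationOn q univ ≤ ENNReal.ofReal V)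
    (hp₀ : 0 ≤ p) (hq₀ : 0 ≤ q) (hpV : ∀ x, p x ≤ V) (hsc : ∀ x, 0 < x → s x ≤ c * x)
    (hc : 0 ≤ c) (hN₀ : N 0 = 0) :
    ∃ k : ℝ → ℝ, (∀ x ≤ 0, k x = 0) ∧
      eVariationOn k univ ≤ ENNReal.ofReal ((2 + 8 * slopeConst c) * V) ∧
      ∀ x, 0 ≤ x → N x = ∫ t in (0 : ℝ)..x, k t := by
  have hV : 0 ≤ V := (hp₀ 0).trans (hpV 0)
  have hp_int := intervalIntegrable_of_boundedVariationOn (hp.trans_lt ENNReal.ofReal_lt_top).ne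
  have hq_int := intervalIntegrable_of_boundedVariationOn (hq.trans_lt ENNReal.ofReal_lt_top).ne
  have hP := monotone_integral_of_nonneg hp_int hp₀
  have hQ := monotone_integral_of_nonneg hq_int hq₀
  have hP_cont := intervalIntegral.continuous_primitive hp_int 0
  have hQ_cont := intervalIntegral.continuous_primitive hq_int 0
  have hP_nonneg (x : ℝ) (hx : 0 ≤ x) : 0 ≤ ∫ t in (0 : ℝ)..x, p t :=
    intervalIntegral.integral_nonneg hx fun t _ ↦ hp₀ t
  have hQs (x : ℝ) (hx : 0 < x) := h.apply_eq hQ hQ_cont hP_nonneg (by simp) hx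
  obtain ⟨s', h', hs', hs's⟩ := h.exists_monotoneOn hP hQ hQ_cont hQs
  have hQs' (x : ℝ) (hx : 0 < x) := h'.apply_eq hQ hQ_cont hP_nonneg (by simp) hx
  have hN_nonneg (x : ℝ) (hx : 0 < x) : 0 ≤ N x := hQs' x hx ▸
    intervalIntegral.integral_nonneg (h'.nonneg x hx) fun t _ ↦ hq₀ t
  set m : ℝ → ℝ := fun x ↦ ((∫ t in (0 : ℝ)..x, p t) - N x) / (x + s' x)
  have hmV : MapsTo m (Ioi 0) (Icc 0 V) := fun x hx ↦ by
    have hden : 0 < x + s' x := add_pos_of_pos_of_nonneg hx (h'.nonneg x hx)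
    have hPx : ∫ t in (0 : ℝ)..x, p t ≤ V * x := by
      simpa [mul_comm] using intervalIntegral.integral_mono_on (le_of_lt hx) (hp_int 0 x)
        (intervalIntegrable_const (μ := volume) (c := V)) fun t _ ↦ hpV t
    refine ⟨div_nonneg (sub_nonneg.2 (h'.apply_le hP hx)) hden.le, (div_le_iff₀ hden).2 ?_⟩
    linarith [hN_nonneg x hx, mul_nonneg hV (h'.nonneg x hx)]
  have hK := slopeConst_nonneg hc
  have hvar := eVariationOn_indicator_Ioi_le hmV (h'.eVariationOn_slope_le hp hq hV hp₀ hq₀ hs'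
    (fun x hx ↦ (hs's x hx).trans (hsc x hx)) hc hQs' hmV) hV (by positivity)
  refine ⟨(Ioi 0).indicator m, fun x hx ↦ indicator_of_notMem (notMem_Ioi.2 hx) m,
    hvar.trans_eq (by ring_nf), fun x hx ↦ ?_⟩
  exact h'.eq_integral hP hP_cont (by simp) hN₀ hN_nonneg hs'
    (fun x hx ↦ indicator_of_mem (mem_Ioi.2 hx) m)
    (intervalIntegrable_of_boundedVariationOn (hvar.trans_lt ENNReal.ofReal_lt_top).ne 0 x) hx

end SlopeVariation

end HalfLineMin

section Maximal

variable {f F : ℝ → ℝ} {a b c x y : ℝ}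

theorem average_comm (f : ℝ → ℝ) (a b : ℝ) : average f a b = average f b a := by
  rw [average, average, intervalIntegral.integral_symm, ← neg_sub a b, inv_neg, neg_mul_neg]

theorem average_comp_neg (f : ℝ → ℝ) (a b : ℝ) :
    average (fun t ↦ f (-t)) a b = average f (-a) (-b) := by
  rw [average_comm f, average, average, intervalIntegral.integral_comp_neg, neg_sub_neg]

theorem average_congr_ae (h : f =ᵐ[volume] F) : average f = average F :=
  funext₂ fun a b ↦ by
    rw [average, average, intervalIntegral.integral_congr_ae (h.mono fun x hx _ ↦ hx)]

theorem maximal_congr_ae (h : f =ᵐ[volume] F) : maximal f = maximal F :=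
  funext fun x ↦ by rw [maximal, maximal, average_congr_ae h]

theorem maximal_comp_neg (f : ℝ → ℝ) (x : ℝ) : maximal (fun t ↦ f (-t)) x = maximal f (-x) := by
  unfold maximal
  congr 1
  ext m
  simp only [mem_ofPred_eq, average_comp_neg]
  constructor
  · rintro ⟨a, b, ha, hb, rfl⟩
    exact ⟨-b, -a, neg_lt_neg hb, neg_lt_neg ha, average_comm f _ _⟩
  · rintro ⟨a, b, ha, hb, rfl⟩
    exact ⟨-b, -a, neg_lt.2 hb, lt_neg.2 ha, by rw [neg_neg, neg_neg, average_comm]⟩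

theorem sSup_average_comp_neg (f : ℝ → ℝ) (c x : ℝ) :
    sSup {m : ℝ | ∃ y : ℝ, y ≠ x ∧ -(c * x) ≤ y ∧ m = average (fun t ↦ f (-t)) y x} =
      sSup {m : ℝ | ∃ y : ℝ, y ≠ -x ∧ y ≤ -(c * -x) ∧ m = average f y (-x)} := by
  congr 1
  ext m
  simp only [mem_ofPred_eq, average_comp_neg]
  constructor
  · rintro ⟨y, hyx, hy, rfl⟩
    exact ⟨-y, neg_injective.ne hyx, by linarith, rfl⟩
  · rintro ⟨y, hyx, hy, rfl⟩
    exact ⟨-y, fun h ↦ hyx (by rw [← h, neg_neg]), by linarith, by rw [neg_neg]⟩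

theorem sub_mul_average (f : ℝ → ℝ) (a b : ℝ) : (b - a) * average f a b = ∫ t in a..b, f t := by
  rcases eq_or_ne a b with rfl | hab
  · simp
  · rw [average, mul_inv_cancel_left₀ (sub_ne_zero.2 hab.symm)]

theorem le_average (hF : Continuous F) (hab : a < b) (h : ∀ t ∈ Icc a b, y ≤ F t) :
    y ≤ average F a b := by
  have hint := intervalIntegral.integral_mono_on hab.le
    (intervalIntegrable_const (μ := volume) (c := y)) (hF.intervalIntegrable a b) h
  rw [intervalIntegral.integral_const, smul_eq_mul] at hint
  rwa [average, le_inv_mul_iff₀ (sub_pos.2 hab)]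

theorem average_le (hF : Continuous F) (hab : a < b) (h : ∀ t ∈ Icc a b, F t ≤ y) :
    average F a b ≤ y := by
  have hint := intervalIntegral.integral_mono_on hab.le (hF.intervalIntegrable a b)
    (intervalIntegrable_const (μ := volume) (c := y)) h
  rw [intervalIntegral.integral_const, smul_eq_mul] at hint
  rwa [average, inv_mul_le_iff₀ (sub_pos.2 hab)]

theorem average_le_maximal (hF : Continuous F) (hF_bdd : BddAbove (range F)) (ha : a < x)
    (hb : x < b) : average F a b ≤ maximal F x := by
  obtain ⟨B, hB⟩ := hF_bdd
  refine le_csSup ⟨B, ?_⟩ ⟨a, b, ha, hb, rfl⟩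
  rintro _ ⟨a, b, ha, hb, rfl⟩
  exact average_le hF (ha.trans hb) fun t _ ↦ hB (mem_range_self t)

theorem maximal_eq_self_of_forall_le (hF : Continuous F) (hx : ∀ y, F y ≤ F x) :
    maximal F x = F x := by
  refine le_antisymm ?_ (le_of_forall_sub_le fun ε hε ↦ ?_)
  · refine csSup_le ⟨_, x - 1, x + 1, sub_one_lt x, lt_add_one x, rfl⟩ ?_
    rintro _ ⟨a, b, ha, hb, rfl⟩
    exact average_le hF (ha.trans hb) fun t _ ↦ hx t
  · obtain ⟨δ, hδ, hδF⟩ := Metric.nhds_basis_closedBall.eventually_iff.1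
      (hF.continuousAt.eventually_const_le (sub_lt_self (F x) hε))
    rw [Real.closedBall_eq_Icc] at hδF
    exact (le_average hF (by linarith) fun t ht ↦ hδF ht).trans
      (average_le_maximal hF ⟨F x, forall_mem_range.2 hx⟩ (sub_lt_self x hδ)
        (lt_add_of_pos_right x hδ))

theorem average_left_le_maximal (hF : Continuous F) (hF_bdd : BddAbove (range F)) (ha : a < x) :
    average F a x ≤ maximal F x := by
  have hcont : ContinuousAt (fun b ↦ average F a b) x :=
    ((continuousAt_id.sub continuousAt_const).inv₀ (sub_ne_zero.2 ha.ne')).mul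
      (intervalIntegral.continuous_primitive hF.intervalIntegrable a).continuousAt
  refine le_of_tendsto (hcont.tendsto.mono_left (nhdsWithin_le_nhds (s := Ioi x))) ?_
  filter_upwards [self_mem_nhdsWithin] with b hb using average_le_maximal hF hF_bdd ha hb

theorem average_le_average_zero (hF : Continuous F) (hr : AntitoneOn F (Ici 0)) (hx : 0 < x)
    (hy : 0 < y) (hyx : y ≠ x) : average F y x ≤ average F 0 x := by
  rcases hyx.lt_or_gt with hyx | hxy
  · have hle : F y ≤ average F 0 y := le_average hF hy fun t ht ↦ hr ht.1 hy.le ht.2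
    have hge : average F y x ≤ F y :=
      average_le hF hyx fun t ht ↦ hr hy.le (hy.le.trans ht.1) ht.1
    have hsplit := intervalIntegral.integral_add_adjacent_intervals
      (hF.intervalIntegrable (μ := volume) 0 y) (hF.intervalIntegrable y x)
    simp only [← sub_mul_average, sub_zero] at hsplit
    refine le_of_mul_le_mul_left ?_ hx
    linarith [mul_le_mul_of_nonneg_left (hge.trans hle) hy.le]
  · calc average F y x = average F x y := average_comm F y x
      _ ≤ F x := average_le hF hxy fun t ht ↦ hr hx.le (hx.le.trans ht.1) ht.1
      _ ≤ average F 0 x := le_average hF hx fun t ht ↦ hr ht.1 hx.le ht.2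

theorem exists_maximal_eq_average (hF : Continuous F) (hF_bdd : BddAbove (range F))
    (hr : AntitoneOn F (Ici 0)) (hc : 0 ≤ c) (hx : 0 < x)
    (hmax : maximal F x = sSup {m : ℝ | ∃ y : ℝ, y ≠ x ∧ -(c * x) ≤ y ∧ m = average F y x}) :
    ∃ s ∈ Icc 0 (c * x), maximal F x = average F (-s) x := by
  have hcx : 0 ≤ c * x := mul_nonneg hc hx.le
  have hcont : ContinuousOn (average F · x) (Icc (-(c * x)) 0) := by
    simp only [average_comm F _ x]
    exact (ContinuousOn.inv₀ (by fun_prop) fun y hy ↦ by linarith [hy.2]).mul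
      (intervalIntegral.continuous_primitive hF.intervalIntegrable x).continuousOn
  obtain ⟨y, hy, hymax⟩ := isCompact_Icc.exists_isMaxOn (nonempty_Icc.2 (neg_nonpos.2 hcx)) hcont
  refine ⟨-y, ⟨neg_nonneg.2 hy.2, neg_le.1 hy.1⟩, ?_⟩
  rw [neg_neg]
  refine le_antisymm (hmax.trans_le ?_) (average_left_le_maximal hF hF_bdd (hy.2.trans_lt hx))
  refine csSup_le ⟨_, 0, hx.ne, neg_nonpos.2 hcx, rfl⟩ ?_
  rintro _ ⟨z, hzx, hcz, rfl⟩
  rcases le_or_gt z 0 with hz | hz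
  · exact hymax ⟨hcz, hz⟩
  · exact (average_le_average_zero hF hr hx hz hzx).trans (hymax ⟨neg_nonpos.2 hcx, le_rfl⟩)

theorem integral_sub_add_integral_sub (hF : Continuous F) (s x : ℝ) :
    (∫ t in (0 : ℝ)..s, (F 0 - F (-t))) + ∫ t in (0 : ℝ)..x, (F 0 - F t) =
      (F 0 - average F (-s) x) * (s + x) := by
  have hF_neg : Continuous fun t ↦ F (-t) := hF.comp continuous_neg
  rw [intervalIntegral.integral_sub (by simp) (hF_neg.intervalIntegrable _ _),
    intervalIntegral.integral_sub (by simp) (hF.intervalIntegrable _ _),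
    intervalIntegral.integral_comp_neg, sub_mul, mul_comm (average F _ _), ← sub_neg_eq_add,
    add_comm s x, ← sub_neg_eq_add x s, sub_mul_average,
    ← intervalIntegral.integral_add_adjacent_intervals (hF.intervalIntegrable (-s) 0)
      (hF.intervalIntegrable 0 x)]
  simp only [intervalIntegral.integral_const, smul_eq_mul, neg_zero]
  ring

theorem exists_isHalfLineMin_maximal (hF : Continuous F) (hF_bdd : BddAbove (range F))
    (hr : AntitoneOn F (Ici 0)) (hc : 0 ≤ c)
    (hmax : ∀ x : ℝ, 0 < x → maximal F x =
      sSup {m : ℝ | ∃ y : ℝ, y ≠ x ∧ -(c * x) ≤ y ∧ m = average F y x}) :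
    ∃ s, IsHalfLineMin (fun x ↦ F 0 - F x) (fun x ↦ F 0 - F (-x)) (fun x ↦ F 0 - maximal F x) s ∧
      ∀ x, 0 < x → s x ≤ c * x := by
  choose! s hs hmax_eq using fun x hx ↦ exists_maximal_eq_average hF hF_bdd hr hc hx (hmax x hx)
  refine ⟨s, ⟨fun x hx ↦ (hs x hx).1, fun x hx ↦ ?_, fun x hx t ht ↦ ?_⟩, fun x hx ↦ (hs x hx).2⟩
  · rw [hmax_eq x hx, integral_sub_add_integral_sub hF]
  · rw [integral_sub_add_integral_sub hF]
    have hle := average_left_le_maximal hF hF_bdd ((neg_nonpos.2 ht).trans_lt hx)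
    exact mul_le_mul_of_nonneg_right (sub_le_sub_left hle _) (add_nonneg ht hx.le)

end Maximal

section Unimodal

theorem monotoneOn_closure_of_ae_eq {β : Type*} [TopologicalSpace β] [Preorder β]
    [OrderClosedTopology β] {f F : ℝ → β} {s : Set ℝ} (hs : IsOpen s) (h : f =ᵐ[volume] F)
    (hF : Continuous F) (hf : MonotoneOn f s) : MonotoneOn F (closure s) := by
  have hdense : closure s ⊆ closure (s ∩ {t | f t = F t}) :=
    closure_minimal ((Measure.dense_of_ae h).open_subset_closure_inter hs) isClosed_closure
  intro x hx y hy hxy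
  rcases hxy.eq_or_lt with rfl | hxy
  · exact le_rfl
  have hmem : (x, y) ∈ closure ((s ∩ {t | f t = F t}) ×ˢ (s ∩ {t | f t = F t})) := by
    rw [closure_prod_eq]
    exact ⟨hdense hx, hdense hy⟩
  refine closure_minimal ?_ (isClosed_le (hF.comp continuous_fst) (hF.comp continuous_snd))
    ((isOpen_lt continuous_fst continuous_snd).inter_closure ⟨hxy, hmem⟩)
  rintro z ⟨hz, ⟨hz₁, hfF₁⟩, hz₂, hfF₂⟩
  exact (congrArg₂ (· ≤ ·) hfF₁ hfF₂).mp (hf hz₁ hz₂ (le_of_lt hz))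

theorem antitoneOn_closure_of_ae_eq {β : Type*} [TopologicalSpace β] [Preorder β]
    [OrderClosedTopology β] {f F : ℝ → β} {s : Set ℝ} (hs : IsOpen s) (h : f =ᵐ[volume] F)
    (hF : Continuous F) (hf : AntitoneOn f s) : AntitoneOn F (closure s) :=
  monotoneOn_closure_of_ae_eq (β := βᵒᵈ) hs h hF hf

theorem le_apply_zero {F : ℝ → ℝ} (hl : MonotoneOn F (Iic 0)) (hr : AntitoneOn F (Ici 0)) (x : ℝ) :
    F x ≤ F 0 := by
  rcases le_total x 0 with hx | hx
  · exact hl hx self_mem_Iic hx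
  · exact hr self_mem_Ici hx hx

variable {F k : ℝ → ℝ} {c V : ℝ}

theorem ae_nonpos_of_antitoneOn (hk : LocallyIntegrable k)
    (hF : ∀ x, F x = F 0 + ∫ t in (0 : ℝ)..x, k t) {s : Set ℝ} (hs : IsOpen s)
    (hF_anti : AntitoneOn F s) : ∀ᵐ t, t ∈ s → k t ≤ 0 := by
  filter_upwards [LocallyIntegrable.ae_hasDerivAt_integral hk] with t ht hts
  have hderiv : HasDerivWithinAt F (k t) s t := by
    simpa only [← hF] using ((ht 0).const_add (F 0)).hasDerivWithinAt
  exact hderiv.derivWithin (hs.uniqueDiffWithinAt hts) ▸ hF_anti.derivWithin_nonpos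

theorem exists_nonneg_sub_eq_integral (hk : eVariationOn k univ ≤ ENNReal.ofReal V) (hV : 0 ≤ V)
    (hF : ∀ x, F x = F 0 + ∫ t in (0 : ℝ)..x, k t) (h₀ : ∀ x, F x ≤ F 0)
    (hr : AntitoneOn F (Ici 0)) :
    ∃ p : ℝ → ℝ, 0 ≤ p ∧ (∀ x, p x ≤ V) ∧ eVariationOn p univ ≤ ENNReal.ofReal V ∧
      ∀ x, 0 ≤ x → F 0 - F x = ∫ t in (0 : ℝ)..x, p t := by
  have hk_bv : BoundedVariationOn k univ := (hk.trans_lt ENNReal.ofReal_lt_top).ne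
  obtain ⟨z, hz⟩ : ∃ z, 0 ≤ k z := by
    by_contra! hneg
    have hpos := intervalIntegral.intervalIntegral_pos_of_pos (f := fun t ↦ -k t)
      (intervalIntegrable_of_boundedVariationOn hk_bv (-1) 0).neg (fun t ↦ neg_pos.2 (hneg t))
      neg_one_lt_zero
    rw [intervalIntegral.integral_neg, ← intervalIntegral.integral_symm] at hpos
    linarith [h₀ (-1), hF (-1)]
  -- As `k z ≥ 0`, the variation of `k` bounds its negative part.
  refine ⟨fun t ↦ (k t)⁻, fun t ↦ negPart_nonneg _, fun x ↦ sup_le ?_ hV, ?_, fun x hx ↦ ?_⟩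
  · have hdist := (eVariationOn.edist_le k (mem_univ z) (mem_univ x)).trans hk
    rw [edist_dist, ENNReal.ofReal_le_ofReal_iff hV, Real.dist_eq] at hdist
    linarith [le_abs_self (k z - k x)]
  · refine le_trans ?_ hk
    simpa [Function.comp_def] using
      (lipschitzWith_negPart (α := ℝ)).lipschitzOnWith.comp_eVariationOn_le (mapsTo_univ k univ)
  · have hk_nonpos := ae_nonpos_of_antitoneOn (locallyIntegrable_of_boundedVariationOn hk_bv) hF
      isOpen_Ioi (hr.mono Ioi_subset_Ici_self)
    rw [hF x, sub_add_cancel_left, ← intervalIntegral.integral_neg]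
    refine intervalIntegral.integral_congr_ae (hk_nonpos.mono fun t ht htx ↦ ?_)
    rw [uIoc_of_le hx] at htx
    exact (negPart_of_nonpos (ht htx.1)).symm

theorem eq_add_integral_sub {G k₁ k₂ : ℝ → ℝ} (hk₁ : ∀ x ≤ 0, k₁ x = 0) (hk₂ : ∀ x ≤ 0, k₂ x = 0)
    (hG₁ : ∀ x, 0 ≤ x → G 0 - G x = ∫ t in (0 : ℝ)..x, k₁ t)
    (hG₂ : ∀ x, 0 ≤ x → G 0 - G (-x) = ∫ t in (0 : ℝ)..x, k₂ t) (x : ℝ) :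
    G x = G 0 + ∫ t in (0 : ℝ)..x, ((fun y ↦ k₂ (-y)) - k₁) t := by
  rcases le_total 0 x with hx | hx
  · have hcongr : ∫ t in (0 : ℝ)..x, ((fun y ↦ k₂ (-y)) - k₁) t = ∫ t in (0 : ℝ)..x, -k₁ t := by
      refine intervalIntegral.integral_congr fun t ht ↦ ?_
      rw [uIcc_of_le hx] at ht
      simp [hk₂ (-t) (neg_nonpos.2 ht.1)]
    rw [hcongr, intervalIntegral.integral_neg, ← hG₁ x hx]
    ring
  · have hcongr : ∫ t in (0 : ℝ)..x, ((fun y ↦ k₂ (-y)) - k₁) t = ∫ t in (0 : ℝ)..x, k₂ (-t) := by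
      refine intervalIntegral.integral_congr fun t ht ↦ ?_
      rw [uIcc_of_ge hx] at ht
      simp [hk₁ t ht.2]
    have hGx := hG₂ (-x) (neg_nonneg.2 hx)
    rw [neg_neg] at hGx
    rw [hcongr, intervalIntegral.integral_comp_neg, neg_zero, intervalIntegral.integral_symm, ← hGx]
    ring

theorem exists_sub_maximal_eq_integral {p q : ℝ → ℝ} (hF : Continuous F) (h₀ : ∀ x, F x ≤ F 0)
    (hr : AntitoneOn F (Ici 0)) (hp : eVariationOn p univ ≤ ENNReal.ofReal V)
    (hq : eVariationOn q univ ≤ ENNReal.ofReal V) (hp₀ : 0 ≤ p) (hq₀ : 0 ≤ q) (hpV : ∀ x, p x ≤ V)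
    (hFp : ∀ x, 0 ≤ x → F 0 - F x = ∫ t in (0 : ℝ)..x, p t)
    (hFq : ∀ x, 0 ≤ x → F 0 - F (-x) = ∫ t in (0 : ℝ)..x, q t) (hc : 0 ≤ c)
    (hmax : ∀ x : ℝ, 0 < x → maximal F x =
      sSup {m : ℝ | ∃ y : ℝ, y ≠ x ∧ -(c * x) ≤ y ∧ m = average F y x}) :
    ∃ k : ℝ → ℝ, (∀ x ≤ 0, k x = 0) ∧
      eVariationOn k univ ≤ ENNReal.ofReal ((2 + 8 * slopeConst c) * V) ∧
      ∀ x, 0 ≤ x → maximal F 0 - maximal F x = ∫ t in (0 : ℝ)..x, k t := by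
  obtain ⟨s, hs, hsc⟩ := exists_isHalfLineMin_maximal hF ⟨F 0, forall_mem_range.2 h₀⟩ hr hc hmax
  rw [maximal_eq_self_of_forall_le hF h₀]
  exact (hs.congr hFp hFq).exists_eq_integral hp hq hp₀ hq₀ hpV hsc hc
    (by rw [maximal_eq_self_of_forall_le hF h₀, sub_self])

theorem exists_hasWeakDeriv_maximal (hk : eVariationOn k univ ≤ ENNReal.ofReal V) (hV : 0 ≤ V)
    (hF : ∀ x, F x = F 0 + ∫ t in (0 : ℝ)..x, k t) (hl : MonotoneOn F (Iic 0))
    (hr : AntitoneOn F (Ici 0)) (hc : 0 ≤ c)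
    (hmax : ∀ x : ℝ, 0 < x → maximal F x =
      sSup {m : ℝ | ∃ y : ℝ, y ≠ x ∧ -(c * x) ≤ y ∧ m = average F y x})
    (hmax' : ∀ x : ℝ, x < 0 → maximal F x =
      sSup {m : ℝ | ∃ y : ℝ, y ≠ x ∧ y ≤ -(c * x) ∧ m = average F y x}) :
    ∃ h, HasWeakDeriv (maximal F) h ∧
      variation h ≤ ENNReal.ofReal (2 * (2 + 8 * slopeConst c) * V) := by
  have hk_bv : BoundedVariationOn k univ := (hk.trans_lt ENNReal.ofReal_lt_top).ne
  have hF_cont := continuous_of_eq_add_integral (locallyIntegrable_of_boundedVariationOn hk_bv) hF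
  have h₀ := le_apply_zero hl hr
  have hl_neg : AntitoneOn (fun x ↦ F (-x)) (Ici 0) := fun x hx y hy hxy ↦
    hl (mem_Iic.2 (neg_nonpos.2 hy)) (mem_Iic.2 (neg_nonpos.2 hx)) (neg_le_neg hxy)
  obtain ⟨p, hp₀, hpV, hp, hFp⟩ := exists_nonneg_sub_eq_integral hk hV hF h₀ hr
  obtain ⟨q, hq₀, hqV, hq, hFq⟩ := exists_nonneg_sub_eq_integral (F := fun x ↦ F (-x))
    (((eVariationOn_comp_neg_le (-k)).trans (eVariationOn_neg_le k univ)).trans hk) hV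
    (fun x ↦ by
      simpa [intervalIntegral.integral_comp_neg, intervalIntegral.integral_symm (-x)]
        using hF (-x)) (fun x ↦ by simpa using h₀ (-x)) hl_neg
  obtain ⟨k₁, hk₁_zero, hk₁, hFk₁⟩ := exists_sub_maximal_eq_integral hF_cont h₀ hr hp hq hp₀ hq₀
    hpV hFp (by simpa using hFq) hc hmax
  obtain ⟨k₂, hk₂_zero, hk₂, hFk₂⟩ := exists_sub_maximal_eq_integral (F := fun x ↦ F (-x))
    (hF_cont.comp continuous_neg) (fun x ↦ by simpa using h₀ (-x)) hl_neg hq hp hq₀ hp₀ hqV hFq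
    (by simpa using hFp) hc fun x hx ↦ by
      rw [maximal_comp_neg, sSup_average_comp_neg, hmax' (-x) (neg_neg_of_pos hx)]
  simp only [maximal_comp_neg, neg_zero] at hFk₂
  have hvar : eVariationOn ((fun x ↦ k₂ (-x)) - k₁) univ ≤
      ENNReal.ofReal (2 * (2 + 8 * slopeConst c) * V) := by
    refine (eVariationOn_sub_le _ _ _).trans
      ((add_le_add ((eVariationOn_comp_neg_le k₂).trans hk₂) hk₁).trans_eq ?_)
    rw [mul_assoc, ENNReal.ofReal_mul two_pos.le, ENNReal.ofReal_ofNat, two_mul]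
  exact ⟨_, hasWeakDeriv_of_eq_add_integral
    (locallyIntegrable_of_boundedVariationOn (hvar.trans_lt ENNReal.ofReal_lt_top).ne)
    (eq_add_integral_sub hk₁_zero hk₂_zero hFk₁ hFk₂), (variation_le_eVariationOn _).trans hvar⟩

end Unimodal

end SecondDerivMaximal

open SecondDerivMaximal

theorem mainTheorem1 :
    ∀ c : ℝ, 0 < c → ∃ C : ℝ, 0 < C ∧ ∀ f : ℝ → ℝ,
      MonotoneOn f (Set.Iio 0) → AntitoneOn f (Set.Ioi 0) →
      (∀ x : ℝ, 0 < x → SecondDerivMaximal.maximal f x =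
        sSup {m : ℝ | ∃ y : ℝ, y ≠ x ∧ -(c * x) ≤ y ∧ m = SecondDerivMaximal.average f y x}) →
      (∀ x : ℝ, x < 0 → SecondDerivMaximal.maximal f x =
        sSup {m : ℝ | ∃ y : ℝ, y ≠ x ∧ y ≤ -(c * x) ∧ m = SecondDerivMaximal.average f y x}) →
      SecondDerivMaximal.variationDeriv (SecondDerivMaximal.maximal f) ≤
        ENNReal.ofReal C * SecondDerivMaximal.variationDeriv f := by
  intro c hc
  have hC : 0 < 2 * (2 + 8 * slopeConst c) := by linarith [slopeConst_nonneg hc.le]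
  refine ⟨_, hC, fun f hl hr hmax hmax' ↦ variationDeriv_le_mul hC fun g hg hvar ↦ ?_⟩
  obtain ⟨F, k, hfF, hk, hF⟩ := hg.exists_boundedVariation_primitive hvar
  have hF_cont : Continuous F := continuous_of_eq_add_integral
    (locallyIntegrable_of_boundedVariationOn (hk.trans_lt hvar.lt_top).ne) hF
  have hFl : MonotoneOn F (Iic 0) := by
    simpa only [closure_Iio] using monotoneOn_closure_of_ae_eq isOpen_Iio hfF hF_cont hl
  have hFr : AntitoneOn F (Ici 0) := by
    simpa only [closure_Ioi] using antitoneOn_closure_of_ae_eq isOpen_Ioi hfF hF_cont hr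
  rw [maximal_congr_ae hfF] at hmax hmax' ⊢
  rw [average_congr_ae hfF] at hmax hmax'
  rw [← ENNReal.ofReal_toReal hvar, ← ENNReal.ofReal_mul hC.le]
  exact exists_hasWeakDeriv_maximal (hk.trans_eq (ENNReal.ofReal_toReal hvar).symm)
    ENNReal.toReal_nonneg hF hFl hFr hc.le hmax hmax'
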